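/- Let $M\ge 1$, $\vec N=(N_1,\dots,N_M)$ with integers $N_k\ge 1$, $q>0$ with $q\ne 1$, $\lambda,\rho\in\mathbb R$, and $X=\prod_{k=1}^M\{0,\dots,N_k\}$; write $|\eta|=\sum_k\eta_k$. Notation: $[a]_q=\frac{q^a-q^{-a}}{q-q^{-1}}$; $(a;q)_n=\prod_{j=0}^{n-1}(1-aq^j)$; $\binom{N}{n}_{q}=\frac{(q;q)_N}{(q;q)_n(q;q)_{N-n}}$; ${}_{r+1}\varphi_r\big(a_1,\dots,a_{r+1};b_1,\dots,b_r;q,z\big)=\sum_{n\ge0}\frac{(a_1;q)_n\cdots(a_{r+1};q)_n}{(b_1;q)_n\cdots(b_r;q)_n}\frac{z^n}{(q;q)_n}$, which stops after the term $n=K$ if some $a_i=q^{-K}$, $K\in\mathbb Z_{\ge0}$. Put $$h^+_k(\xi)=\rho+\sum_{j=k}^M(2\xi_j-N_j),\qquad h^-_k(\zeta)=\lambda+\sum_{j=1}^k(2\zeta_j-N_j).$$ **Processes.** Let $c^+_k(\eta)=q^{-(\eta_{k+1}+N_k-\eta_k+1)}[\eta_k]_q[N_{k+1}-\eta_{k+1}]_q$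 and $c^-_k(\eta)=q^{\eta_{k-1}+N_k-\eta_k+1}[\eta_k]_q[N_{k-1}-\eta_{k-1}]_q$. $\mathrm{ASEP}_{\mathsf R}(q,\vec N,\rho)$ and $\mathrm{ASEP}_{\mathsf L}(q,\vec N,\lambda)$ are the Markov jump processes on $X$ with generators $$L^{\mathsf A}f(\xi)=\sum_{k=1}^{M-1}C^{\mathsf A,+}_k(\xi)\,[f(\xi^{k,k+1})-f(\xi)]+C^{\mathsf A,-}_{k+1}(\xi)\,[f(\xi^{k+1,k})-f(\xi)],\qquad \mathsf A\in\{\mathsf R,\mathsf L\},$$ where $\xi^{i,j}$ is $\xi$ with one particle moved from site $i$ to site $j$, and, with $h^+_k=h^+_k(\xi)$ and $h^-_k=h^-_k(\zeta)$, $$C^{\mathsf R,+}_k(\xi)=c^+_k(\xi)\frac{(1+q^{2\xi_k-2h^+_k})(1+q^{2\xi_{k+1}-2h^+_{k+1}})}{(1+q^{-2h^+_{k+1}})(1+q^{-2h^+_{k+1}-2})},\qquad C^{\mathsf R,-}_k(\xi)=c^-_k(\xi)\frac{(1+q^{-2\xi_{k-1}-2h^+_k})(1+q^{-2\xi_k-2h^+_{k+1}})}{(1+q^{-2h^+_k})(1+q^{-2h^+_k+2})},$$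 $$C^{\mathsf L,+}_k(\zeta)=c^+_k(\zeta)\frac{(1+q^{2(h^-_{k-1}+\zeta_k)})(1+q^{2(h^-_k+\zeta_{k+1})})}{(1+q^{2h^-_k})(1+q^{2(h^-_k-1)})},\qquad C^{\mathsf L,-}_k(\zeta)=c^-_k(\zeta)\frac{(1+q^{2(h^-_{k-1}-\zeta_{k-1})})(1+q^{2(h^-_k-\zeta_k)})}{(1+q^{2h^-_{k-1}})(1+q^{2(h^-_{k-1}+1)})}.$$ **Krawtchouk functions.** Let $K_n(x;c,N;q)={}_3\varphi_2(q^{-n},q^{-x},-cq^{x-N};q^{-N},0;q,q)$ and $k(n,x;\rho;N;q)=(-1)^nq^{-n\rho}q^{\frac12n(N-1)}K_n(x;q^{2\rho},N;q^2)$. For $\eta,\zeta,\xi\in X$ let $u(\eta)=\sum_{k=1}^M\big(\eta_kN_k-2\eta_k\sum_{j=1}^kN_j\big)$, $$K_{\mathsf R}(\eta,\xi)=q^{-\frac12u(\eta)}\prod_{k=1}^Mk(\eta_k,\xi_k;h^+_{k+1}(\xi);N_k;q),\qquad K_{\mathsf L}(\eta,\zeta)=q^{-\frac12u(\eta)}\prod_{k=1}^Mk(\eta_k,\zeta_k;h^-_{k-1}(\zeta);N_k;q^{-1}),$$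 $w(\eta)=q^{u(\eta)}\prod_{k=1}^Mq^{\eta_k(\eta_k-N_k)}\binom{N_k}{\eta_k}_{q^2}$, and for $v\in\mathbb R\setminus\{0\}$ $$R^v(\zeta,\xi)=\sum_{\eta\in X}K_{\mathsf L}(\eta,\zeta)K_{\mathsf R}(\eta,\xi)\,w(\eta)\,(-v)^{|\eta|}.$$ **Racah functions.** Let $R_n(x;\alpha,\beta,\gamma,\delta;q)={}_4\varphi_3(q^{-n},\alpha\beta q^{n+1},q^{-x},\gamma\delta q^{x+1};\alpha q,\beta\delta q,\gamma q;q,q)$ and $$r(y,x;\lambda,\rho,v,N;q)=v^y\,\frac{(-vq^{\rho+\lambda-N+1};q^2)_x\,(-v^{-1}q^{\rho+\lambda-N+1};q^2)_y\,(vq^{2y-\rho+\lambda-N+1};q^2)_N}{q^{y(y+\rho+\lambda-N)}\,(vq^{-2x-\rho+\lambda+N+1};q^2)_{x+y}}\;R_x(y;\alpha,\beta,\gamma,\delta;q^2),$$ $$(\alpha,\beta,\gamma,\delta)=\big(-v^{-1}q^{\rho+\lambda-N-1},\;vq^{\rho-\lambda-N-1},\;q^{-2N-2},\;-q^{2\lambda}\big).$$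 **Theorem.** For every $v\in\mathbb R\setminus\{0\}$: 1. $R^v$ is a duality function between $\mathrm{ASEP}_{\mathsf L}(q,\vec N,\lambda)$ and $\mathrm{ASEP}_{\mathsf R}(q,\vec N,\rho)$: $[L^{\mathsf L}R^v(\cdot,\xi)](\zeta)=[L^{\mathsf R}R^v(\zeta,\cdot)](\xi)$ for all $\zeta,\xi\in X$. 2. For all $\zeta,\xi\in X$, $$R^v(\zeta,\xi)=\prod_{k=1}^Mr\big(\zeta_k,\xi_k;h^-_{k-1}(\zeta),h^+_{k+1}(\xi),v,N_k;q\big),$$ whenever no denominator on the right-hand side vanishes. For fixed $\zeta,\xi$ this condition holds for all $v'\neq v$ in some neighbourhood of $v$, and if it fails at $v$ itself, the identity still holds with the right-hand side replaced by its limit as $v'\to v$, $v'\ne v$. -/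

import Mathlib

open Filter Topology

noncomputable section

namespace DynASEP

/-! ### Markov duality -/

/-- Duality of two Markov generators `L`, `L'` (acting on all real functions on the finite state
spaces `X`, `Y`) with respect to `D : X → Y → ℝ`: `[L D(·, y)](x) = [L' D(x, ·)](y)`. -/
def IsDualityFunction {X Y : Type*} (L : (X → ℝ) → X → ℝ) (L' : (Y → ℝ) → Y → ℝ)
    (D : X → Y → ℝ) : Prop :=
  ∀ x y, L (fun x' => D x' y) x = L' (fun y' => D x y') y

/-! ### `q`-notation -/

/-- `[a]_q`. -/
def qNum (q a : ℝ) : ℝ := if q = 1 then a else (q ^ a - q ^ (-a)) / (q - q⁻¹)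

/-- The `q`-shifted factorial `(a;q)_n`. -/
def qPoch (a q : ℝ) (n : ℕ) : ℝ := ∏ j ∈ Finset.range n, (1 - a * q ^ j)

/-- The `q`-binomial coefficient, used for `k ≤ n`. -/
def qBinom (q : ℝ) (n k : ℕ) : ℝ := qPoch q q n / (qPoch q q k * qPoch q q (n - k))

/-- The `q`-hypergeometric series with upper parameters `as`, lower parameters `bs`, base `q` and
argument `z` (for one more upper than lower parameter). If an upper parameter is `q ^ (-n)` with
`n : ℕ`, all terms beyond the `n`-th are zero, also those whose denominator vanishes. -/
def qHyp (as bs : List ℝ) (q z : ℝ) : ℝ :=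
  ∑' n : ℕ, (as.map fun a => qPoch a q n).prod / (bs.map fun b => qPoch b q n).prod
    * (z ^ n / qPoch q q n)

/-- The (dual) `q`-Krawtchouk polynomial `K_n(x;c,N;q)`. -/
def qKrawtchouk (n x : ℕ) (c : ℝ) (N : ℕ) (q : ℝ) : ℝ :=
  qHyp [q ^ (-(n : ℝ)), q ^ (-(x : ℝ)), -c * q ^ ((x : ℝ) - N)] [q ^ (-(N : ℝ)), 0] q q

/-- The `q`-Racah polynomial `R_n(x;α,β,γ,δ;q)`. -/
def qRacah (n x : ℕ) (α β γ δ q : ℝ) : ℝ :=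
  qHyp [q ^ (-(n : ℝ)), α * β * q ^ ((n : ℝ) + 1), q ^ (-(x : ℝ)), γ * δ * q ^ ((x : ℝ) + 1)]
    [α * q, β * δ * q, γ * q] q q

/-! ### State space and height functions

There are `M = m + 1` sites. The site `k ∈ {1, …, M}` is the element `i : Fin (m + 1)` with
`k = i + 1`. The bond `b : Fin m` joins the neighbouring sites `b.castSucc` and `b.succ`. -/

/-- The state space `{0,…,N_1} × ⋯ × {0,…,N_M}`. -/
abbrev Config {m : ℕ} (N : Fin (m + 1) → ℕ) : Type := (i : Fin (m + 1)) → Fin (N i + 1)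

/-- The total number of particles `|η|`. -/
def total {m : ℕ} {N : Fin (m + 1) → ℕ} (η : Config N) : ℕ := ∑ i, (η i : ℕ)

/-- The state `η^{i,j}` after one particle has moved from site `i` to site `j ≠ i`. If this move is
impossible (no particle at `i`, or `j` full), the state is left unchanged; the rates below vanish
in that case. -/
def jump {m : ℕ} {N : Fin (m + 1) → ℕ} (η : Config N) (i j : Fin (m + 1)) : Config N :=
  if h : 0 < (η i : ℕ) ∧ (η j : ℕ) < N j then
    Function.update
      (Function.update η i ⟨(η i : ℕ) - 1, lt_of_le_of_lt (Nat.sub_le _ _) (η i).isLt⟩)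
      j ⟨(η j : ℕ) + 1, Nat.succ_lt_succ h.2⟩
  else η

/-- `h⁺_k(ξ) = ρ + ∑_{j=k}^M (2 ξ_j - N_j)`, for `k = 1, …, M + 1`. -/
def hPlus {m : ℕ} {N : Fin (m + 1) → ℕ} (ρ : ℝ) (ξ : Config N) (k : ℕ) : ℝ :=
  ρ + ∑ j : Fin (m + 1), if k ≤ (j : ℕ) + 1 then 2 * ((ξ j : ℕ) : ℝ) - N j else 0

/-- `h⁻_k(ζ) = lam + ∑_{j=1}^k (2 ζ_j - N_j)`, for `k = 0, …, M`. -/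
def hMinus {m : ℕ} {N : Fin (m + 1) → ℕ} (lam : ℝ) (ζ : Config N) (k : ℕ) : ℝ :=
  lam + ∑ j : Fin (m + 1), if (j : ℕ) + 1 ≤ k then 2 * ((ζ j : ℕ) : ℝ) - N j else 0

/-! ### Jump rates and generators -/

/-- ASEP rate `c⁺` for a jump from site `i` to its right neighbour `j`. -/
def cPlus {m : ℕ} {N : Fin (m + 1) → ℕ} (q : ℝ) (η : Config N) (i j : Fin (m + 1)) : ℝ :=
  q ^ (-(((η j : ℕ) : ℝ) + N i - ((η i : ℕ) : ℝ) + 1))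
    * qNum q ((η i : ℕ) : ℝ) * qNum q (N j - ((η j : ℕ) : ℝ))

/-- ASEP rate `c⁻` for a jump from site `i` to its left neighbour `j`. -/
def cMinus {m : ℕ} {N : Fin (m + 1) → ℕ} (q : ℝ) (η : Config N) (i j : Fin (m + 1)) : ℝ :=
  q ^ (((η j : ℕ) : ℝ) + N i - ((η i : ℕ) : ℝ) + 1)
    * qNum q ((η i : ℕ) : ℝ) * qNum q (N j - ((η j : ℕ) : ℝ))

/-- Rate `C^{R,+}_k` of ASEP_R for a jump from site `i` (with `k = i + 1`) to its right
neighbour `j`. -/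
def CRPlus {m : ℕ} {N : Fin (m + 1) → ℕ} (q ρ : ℝ) (ξ : Config N) (i j : Fin (m + 1)) : ℝ :=
  let k : ℕ := i + 1
  cPlus q ξ i j *
    (((1 + q ^ (2 * ((ξ i : ℕ) : ℝ) - 2 * hPlus ρ ξ k))
        * (1 + q ^ (2 * ((ξ j : ℕ) : ℝ) - 2 * hPlus ρ ξ (k + 1))))
      / ((1 + q ^ (-2 * hPlus ρ ξ (k + 1))) * (1 + q ^ (-2 * hPlus ρ ξ (k + 1) - 2))))

/-- Rate `C^{R,-}_k` of ASEP_R for a jump from site `i` (with `k = i + 1`) to its left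
neighbour `j`. -/
def CRMinus {m : ℕ} {N : Fin (m + 1) → ℕ} (q ρ : ℝ) (ξ : Config N) (i j : Fin (m + 1)) : ℝ :=
  let k : ℕ := i + 1
  cMinus q ξ i j *
    (((1 + q ^ (-2 * ((ξ j : ℕ) : ℝ) - 2 * hPlus ρ ξ k))
        * (1 + q ^ (-2 * ((ξ i : ℕ) : ℝ) - 2 * hPlus ρ ξ (k + 1))))
      / ((1 + q ^ (-2 * hPlus ρ ξ k)) * (1 + q ^ (-2 * hPlus ρ ξ k + 2))))

/-- Rate `C^{L,+}_k` of ASEP_L for a jump from site `i` (with `k = i + 1`) to its right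
neighbour `j`. -/
def CLPlus {m : ℕ} {N : Fin (m + 1) → ℕ} (q lam : ℝ) (ζ : Config N) (i j : Fin (m + 1)) : ℝ :=
  let k : ℕ := i + 1
  cPlus q ζ i j *
    (((1 + q ^ (2 * (hMinus lam ζ (k - 1) + ((ζ i : ℕ) : ℝ))))
        * (1 + q ^ (2 * (hMinus lam ζ k + ((ζ j : ℕ) : ℝ)))))
      / ((1 + q ^ (2 * hMinus lam ζ k)) * (1 + q ^ (2 * (hMinus lam ζ k - 1)))))

/-- Rate `C^{L,-}_k` of ASEP_L for a jump from site `i` (with `k = i + 1`) to its left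
neighbour `j`. -/
def CLMinus {m : ℕ} {N : Fin (m + 1) → ℕ} (q lam : ℝ) (ζ : Config N) (i j : Fin (m + 1)) : ℝ :=
  let k : ℕ := i + 1
  cMinus q ζ i j *
    (((1 + q ^ (2 * (hMinus lam ζ (k - 1) - ((ζ j : ℕ) : ℝ))))
        * (1 + q ^ (2 * (hMinus lam ζ k - ((ζ i : ℕ) : ℝ)))))
      / ((1 + q ^ (2 * hMinus lam ζ (k - 1))) * (1 + q ^ (2 * (hMinus lam ζ (k - 1) + 1)))))

/-- The generator of ASEP_R(q, N, ρ). -/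
def genR {m : ℕ} (q : ℝ) (N : Fin (m + 1) → ℕ) (ρ : ℝ) (f : Config N → ℝ) (ξ : Config N) : ℝ :=
  ∑ b : Fin m,
    (CRPlus q ρ ξ b.castSucc b.succ * (f (jump ξ b.castSucc b.succ) - f ξ)
      + CRMinus q ρ ξ b.succ b.castSucc * (f (jump ξ b.succ b.castSucc) - f ξ))

/-- The generator of ASEP_L(q, N, lam). -/
def genL {m : ℕ} (q : ℝ) (N : Fin (m + 1) → ℕ) (lam : ℝ) (f : Config N → ℝ) (ζ : Config N) : ℝ :=
  ∑ b : Fin m,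
    (CLPlus q lam ζ b.castSucc b.succ * (f (jump ζ b.castSucc b.succ) - f ζ)
      + CLMinus q lam ζ b.succ b.castSucc * (f (jump ζ b.succ b.castSucc) - f ζ))

/-! ### Krawtchouk duality functions with ASEP -/

/-- `k(n,x;ρ,N;q) = (-1)^n q^{-nρ} q^{n(N-1)/2} K_n(x;q^{2ρ},N;q²)`. -/
def kSite (n x : ℕ) (ρ : ℝ) (N : ℕ) (q : ℝ) : ℝ :=
  (-1) ^ n * q ^ (-((n : ℝ) * ρ)) * q ^ ((n : ℝ) * ((N : ℝ) - 1) / 2)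
    * qKrawtchouk n x (q ^ (2 * ρ)) N (q ^ 2)

/-- `u(η) = ∑_k (η_k N_k - 2 η_k ∑_{j ≤ k} N_j)`. -/
def uExp {m : ℕ} {N : Fin (m + 1) → ℕ} (η : Config N) : ℝ :=
  ∑ i : Fin (m + 1), (((η i : ℕ) : ℝ) * N i
    - 2 * ((η i : ℕ) : ℝ) * ∑ j : Fin (m + 1), if j ≤ i then (N j : ℝ) else 0)

/-- `K_R(η,ξ)`; the `k`-th factor has parameter `h⁺_{k+1}(ξ)`, `k = i + 1`. -/
def KR {m : ℕ} {N : Fin (m + 1) → ℕ} (q ρ : ℝ) (η ξ : Config N) : ℝ :=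
  q ^ (-(1 / 2) * uExp η)
    * ∏ i : Fin (m + 1), kSite (η i) (ξ i) (hPlus ρ ξ ((i : ℕ) + 2)) (N i) q

/-- `K_L(η,ζ)`; the `k`-th factor has parameter `h⁻_{k-1}(ζ)`, `k = i + 1`, and base `q⁻¹`. -/
def KL {m : ℕ} {N : Fin (m + 1) → ℕ} (q lam : ℝ) (η ζ : Config N) : ℝ :=
  q ^ (-(1 / 2) * uExp η)
    * ∏ i : Fin (m + 1), kSite (η i) (ζ i) (hMinus lam ζ (i : ℕ)) (N i) q⁻¹

/-- The one-site weight `w(n;N;q) = q^{n(n-N)} [N choose n]_{q²}`. -/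
def wSite (n N : ℕ) (q : ℝ) : ℝ := q ^ ((n : ℝ) * ((n : ℝ) - N)) * qBinom (q ^ 2) N n

/-- The weight `w(η) = q^{u(η)} ∏_k w(η_k;N_k;q)` on the state space. -/
def wConfig {m : ℕ} {N : Fin (m + 1) → ℕ} (q : ℝ) (η : Config N) : ℝ :=
  q ^ uExp η * ∏ i : Fin (m + 1), wSite (η i) (N i) q

/-- `R^v(ζ,ξ) = ∑_η K_L(η,ζ) K_R(η,ξ) w(η) (-v)^{|η|}`. -/
def Rv {m : ℕ} {N : Fin (m + 1) → ℕ} (q lam ρ v : ℝ) (ζ ξ : Config N) : ℝ :=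
  ∑ η : Config N, KL q lam η ζ * KR q ρ η ξ * wConfig q η * (-v) ^ total η

/-! ### One-site `q`-Racah duality functions -/

/-- The coefficient `c_r(y,x;lam,ρ,v,N;q)`. -/
def cr (y x : ℕ) (lam ρ v : ℝ) (N : ℕ) (q : ℝ) : ℝ :=
  v ^ y *
    ((qPoch (-v * q ^ (ρ + lam - N + 1)) (q ^ 2) x
        * qPoch (-v⁻¹ * q ^ (ρ + lam - N + 1)) (q ^ 2) y
        * qPoch (v * q ^ (2 * (y : ℝ) - ρ + lam - N + 1)) (q ^ 2) N)
      / (q ^ ((y : ℝ) * ((y : ℝ) + ρ + lam - N))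
        * qPoch (v * q ^ (-2 * (x : ℝ) - ρ + lam + N + 1)) (q ^ 2) (x + y)))

/-- The one-site duality function
`r(y,x;lam,ρ,v,N;q) = c_r(y,x;lam,ρ,v,N;q) R_x(y;α,β,γ,δ;q²)` with
`(α,β,γ,δ) = (-v⁻¹ q^{ρ+lam-N-1}, v q^{ρ-lam-N-1}, q^{-2N-2}, -q^{2 lam})`. -/
def rSite (y x : ℕ) (lam ρ v : ℝ) (N : ℕ) (q : ℝ) : ℝ :=
  cr y x lam ρ v N q *
    qRacah x y (-v⁻¹ * q ^ (ρ + lam - N - 1)) (v * q ^ (ρ - lam - N - 1))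
      (q ^ (-2 * (N : ℝ) - 2)) (-q ^ (2 * lam)) (q ^ 2)

/-- No denominator in the definition of `r(y,x;lam,ρ,v,N;q)` vanishes: neither the one in `c_r`, nor
one in the `min x y + 1` terms of the terminating `₄φ₃`. (The third lower parameter `q^{-2N}` and
the base never give a zero denominator there if `x, y ≤ N`.) -/
def RegularSite (y x : ℕ) (lam ρ v : ℝ) (N : ℕ) (q : ℝ) : Prop :=
  qPoch (v * q ^ (-2 * (x : ℝ) - ρ + lam + N + 1)) (q ^ 2) (x + y) ≠ 0 ∧
  qPoch (-v⁻¹ * q ^ (ρ + lam - N + 1)) (q ^ 2) (min x y) ≠ 0 ∧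
  qPoch (-v * q ^ (ρ + lam - N + 1)) (q ^ 2) (min x y) ≠ 0

/-- The doubly nested product `∏_k r(ζ_k,ξ_k;h⁻_{k-1}(ζ),h⁺_{k+1}(ξ),v,N_k;q)`, `k = i + 1`. -/
def racahProduct {m : ℕ} {N : Fin (m + 1) → ℕ} (q lam ρ v : ℝ) (ζ ξ : Config N) : ℝ :=
  ∏ i : Fin (m + 1),
    rSite (ζ i) (ξ i) (hMinus lam ζ (i : ℕ)) (hPlus ρ ξ ((i : ℕ) + 2)) v (N i) q

/-- All factors of the doubly nested product are free of zero denominators. -/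
def Regular {m : ℕ} {N : Fin (m + 1) → ℕ} (q lam ρ v : ℝ) (ζ ξ : Config N) : Prop :=
  ∀ i : Fin (m + 1),
    RegularSite (ζ i) (ξ i) (hMinus lam ζ (i : ℕ)) (hPlus ρ ξ ((i : ℕ) + 2)) v (N i) q

end DynASEP

end

open DynASEP

noncomputable section

/-!
The generating functions in `n` of the one-site Krawtchouk functions are products of two
`q`-shifted factorials. The generator of the exclusion process on a bond acts on a product of two of
them as a `q`-difference operator, which turns duality with the dynamic process into an identity of
rational functions for a single bond. The case of `K_L` follows from that of `K_R` by `q ↦ q⁻¹` and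
reflection of the lattice; since `w(η) (-v)^|η|` is reversible for the exclusion process, summing
over `η` then moves the generator from one duality function to the other.

The weight and the phases `q^{u(η)}` factorise, so `R^v` is a product of one-site sums
`∑_n k(n,y) k(n,x) w(n) (-v)^n`. Such a sum pairs two generating functions. Expanding one of them by
the `q`-Vandermonde identity in a basis of products of `q`-shifted factorials whose pairing with the
other has a closed form gives the `q`-Racah polynomial term by term.
-/

namespace DynASEP

/-! ### `q`-shifted factorials and Gaussian binomial coefficients -/

@[simp] lemma qPoch_zero (a p : ℝ) : qPoch a p 0 = 1 := by simp [qPoch]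

lemma qPoch_succ (a p : ℝ) (n : ℕ) : qPoch a p (n + 1) = qPoch a p n * (1 - a * p ^ n) := by
  simp [qPoch, Finset.prod_range_succ]

lemma qPoch_succ_left (a p : ℝ) (n : ℕ) : qPoch a p (n + 1) = (1 - a) * qPoch (a * p) p n := by
  simp only [qPoch, Finset.prod_range_succ', pow_zero, mul_one]
  rw [mul_comm]
  congr 1
  exact Finset.prod_congr rfl fun j _ => by ring

lemma qPoch_add (a p : ℝ) (m n : ℕ) :
    qPoch a p (m + n) = qPoch a p m * qPoch (a * p ^ m) p n := by
  simp only [qPoch, Finset.prod_range_add]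
  congr 1
  exact Finset.prod_congr rfl fun j _ => by ring

lemma qPoch_mul_base (a p : ℝ) (n : ℕ) :
    (1 - a) * qPoch (a * p) p n = qPoch a p n * (1 - a * p ^ n) := by
  rw [← qPoch_succ_left, qPoch_succ]

/-- The homogeneous `q`-shifted factorial `(a - b)(a - bp)⋯(a - bp^{n-1})`, written `(a - b)^n_p`
in `q`-calculus. -/
def qSubPow (a b p : ℝ) (n : ℕ) : ℝ := ∏ j ∈ Finset.range n, (a - b * p ^ j)

@[simp] lemma qSubPow_zero (a b p : ℝ) : qSubPow a b p 0 = 1 := by simp [qSubPow]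

lemma qSubPow_succ (a b p : ℝ) (n : ℕ) :
    qSubPow a b p (n + 1) = qSubPow a b p n * (a - b * p ^ n) := by
  simp [qSubPow, Finset.prod_range_succ]

lemma qSubPow_zero_right (a p : ℝ) (n : ℕ) : qSubPow a 0 p n = a ^ n := by simp [qSubPow]

lemma qSubPow_mul_left (a b p : ℝ) (n : ℕ) : qSubPow a (a * b) p n = a ^ n * qPoch b p n := by
  induction n with
  | zero => simp
  | succ n ih =>
    rw [qSubPow_succ, ih, qPoch_succ]
    ring

lemma one_sub_pow_ne_zero {p : ℝ} (hp : 0 < p) (hp1 : p ≠ 1) (n : ℕ) : 1 - p ^ (n + 1) ≠ 0 :=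
  fun h => hp1 ((pow_eq_one_iff_of_nonneg hp.le n.succ_ne_zero).1 (sub_eq_zero.1 h).symm)

lemma qPoch_self_ne_zero {p : ℝ} (hp : 0 < p) (hp1 : p ≠ 1) (n : ℕ) : qPoch p p n ≠ 0 :=
  Finset.prod_ne_zero_iff.2 fun j _ => by
    rw [← pow_succ']
    exact one_sub_pow_ne_zero hp hp1 j

/-- Gaussian binomial coefficients, by Pascal's rule; unlike `qBinom` they vanish above the
diagonal. -/
def gaussBinom (p : ℝ) : ℕ → ℕ → ℝ
  | _, 0 => 1
  | 0, _ + 1 => 0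
  | n + 1, k + 1 => gaussBinom p n k + p ^ (k + 1) * gaussBinom p n (k + 1)

@[simp] lemma gaussBinom_zero_right (p : ℝ) (n : ℕ) : gaussBinom p n 0 = 1 := by
  cases n <;> rfl

lemma gaussBinom_succ_succ (p : ℝ) (n k : ℕ) : gaussBinom p (n + 1) (k + 1) =
    gaussBinom p n k + p ^ (k + 1) * gaussBinom p n (k + 1) := rfl

lemma gaussBinom_eq_zero (p : ℝ) : ∀ {n k : ℕ}, n < k → gaussBinom p n k = 0
  | 0, k + 1, _ => rfl
  | n + 1, k + 1, h => by
    rw [gaussBinom_succ_succ, gaussBinom_eq_zero p (by omega), gaussBinom_eq_zero p (by omega)]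
    simp

@[simp] lemma gaussBinom_self (p : ℝ) (n : ℕ) : gaussBinom p n n = 1 := by
  induction n with
  | zero => simp
  | succ n ih => simp [gaussBinom_succ_succ, ih, gaussBinom_eq_zero p n.lt_succ_self]

lemma gaussBinom_pos {p : ℝ} (hp : 0 < p) : ∀ {n k : ℕ}, k ≤ n → 0 < gaussBinom p n k
  | _, 0, _ => by simp
  | n + 1, k + 1, h => by
    have hk := gaussBinom_pos hp (Nat.le_of_succ_le_succ h)
    rw [gaussBinom_succ_succ]
    rcases Nat.lt_or_ge n (k + 1) with hlt | hle
    · simpa [gaussBinom_eq_zero p hlt] using hk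
    · have := gaussBinom_pos hp hle
      positivity

lemma gaussBinom_succ_right_mul (p : ℝ) : ∀ {n k : ℕ}, k ≤ n →
    gaussBinom p n (k + 1) * (1 - p ^ (k + 1)) = gaussBinom p n k * (1 - p ^ (n - k))
  | 0, 0, _ => by simp [gaussBinom_eq_zero]
  | n + 1, 0, _ => by
    have ih := gaussBinom_succ_right_mul p (Nat.zero_le n)
    simp only [gaussBinom_succ_succ, gaussBinom_zero_right, Nat.sub_zero, zero_add,
      pow_succ] at ih ⊢
    linear_combination p * ih
  | n + 1, k + 1, h => by
    obtain hk : k ≤ n := Nat.le_of_succ_le_succ h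
    have ih₀ := gaussBinom_succ_right_mul p hk
    rw [gaussBinom_succ_succ p n (k + 1), gaussBinom_succ_succ p n k, Nat.add_sub_add_right]
    rcases hk.eq_or_lt with rfl | hlt
    · simp [gaussBinom_eq_zero]
    · have ih₁ := gaussBinom_succ_right_mul p (k := k + 1) hlt
      obtain ⟨d, rfl⟩ : ∃ d, n = k + 1 + d := Nat.exists_eq_add_of_le hlt
      rw [show k + 1 + d - (k + 1) = d by omega] at ih₁
      rw [show k + 1 + d - k = d + 1 by omega] at ih₀ ⊢
      linear_combination p ^ (k + 2) * ih₁ + ih₀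

lemma gaussBinom_add_mul (p : ℝ) (k m : ℕ) :
    gaussBinom p (k + m) k * (qPoch p p k * qPoch p p m) = qPoch p p (k + m) := by
  induction k generalizing m with
  | zero => simp
  | succ k ih =>
    have absorb := gaussBinom_succ_right_mul p (n := k + (m + 1)) (k := k) (by omega)
    rw [Nat.add_sub_cancel_left] at absorb
    rw [show k + 1 + m = k + (m + 1) by ring, ← ih (m + 1), qPoch_succ p p k, qPoch_succ p p m,
      ← pow_succ', ← pow_succ']
    linear_combination qPoch p p k * qPoch p p m * absorb

lemma qBinom_eq_gaussBinom {p : ℝ} (hp : 0 < p) (hp1 : p ≠ 1) {n k : ℕ} (h : k ≤ n) :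
    qBinom p n k = gaussBinom p n k := by
  obtain ⟨m, rfl⟩ := Nat.exists_eq_add_of_le h
  rw [qBinom, Nat.add_sub_cancel_left, ← gaussBinom_add_mul,
    mul_div_cancel_right₀ _
      (mul_ne_zero (qPoch_self_ne_zero hp hp1 k) (qPoch_self_ne_zero hp hp1 m))]

lemma gaussBinom_mul_gaussBinom {p : ℝ} (hp : 0 < p) (hp1 : p ≠ 1) (j m l : ℕ) :
    gaussBinom p (j + m + l) (j + m) * gaussBinom p (j + m) j
      = gaussBinom p (j + m + l) j * gaussBinom p (m + l) m := by
  have hj := qPoch_self_ne_zero hp hp1 j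
  have hm := qPoch_self_ne_zero hp hp1 m
  have hl := qPoch_self_ne_zero hp hp1 l
  have e₁ := gaussBinom_add_mul p (j + m) l
  have e₂ := gaussBinom_add_mul p j m
  have e₃ := gaussBinom_add_mul p j (m + l)
  have e₄ := gaussBinom_add_mul p m l
  rw [← add_assoc] at e₃
  refine mul_right_cancel₀ (mul_ne_zero hj (mul_ne_zero hm hl)) ?_
  linear_combination gaussBinom p (j + m + l) (j + m) * qPoch p p l * e₂ + e₁ - e₃
    - gaussBinom p (j + m + l) j * qPoch p p j * e₄

lemma qPoch_inv_pow {p : ℝ} (hp : p ≠ 0) (n j : ℕ) : qPoch (p ^ n)⁻¹ p j =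
    (-1) ^ j * p ^ j.choose 2 / p ^ (n * j) * (gaussBinom p n j * qPoch p p j) := by
  induction j with
  | zero => simp
  | succ j ih =>
    rw [qPoch_succ, ih, qPoch_succ, ← pow_succ', Nat.choose_succ_succ' j 1, Nat.choose_one_right]
    rcases Nat.lt_or_ge n j with hlt | hle
    · simp [gaussBinom_eq_zero p hlt, gaussBinom_eq_zero p (hlt.trans j.lt_succ_self)]
    · have absorb := gaussBinom_succ_right_mul p hle
      obtain ⟨m, rfl⟩ := Nat.exists_eq_add_of_le hle
      rw [Nat.add_sub_cancel_left] at absorb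
      have factor : 1 - (p ^ (j + m))⁻¹ * p ^ j = -(1 - p ^ m) / p ^ m := by
        rw [pow_add]
        field_simp
        ring
      have shift : p ^ ((j + m) * (j + 1)) = p ^ ((j + m) * j) * p ^ j * p ^ m := by ring
      rw [factor, shift, pow_succ (-1 : ℝ), pow_add p j]
      field_simp
      linear_combination (qPoch p p j) * absorb

lemma sum_gaussBinom_mul_pow (p T : ℝ) (n : ℕ) :
    ∑ k ∈ Finset.range (n + 1), (-1) ^ k * p ^ k.choose 2 * gaussBinom p n k * T ^ k
      = qPoch T p n := by
  induction n generalizing T with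
  | zero => simp
  | succ n ih =>
    set f : ℕ → ℝ := fun k => (-1) ^ k * p ^ k.choose 2 * gaussBinom p n k * (T * p) ^ k with hf
    have pascal : ∀ k, (-1) ^ (k + 1) * p ^ (k + 1).choose 2 * gaussBinom p (n + 1) (k + 1)
        * T ^ (k + 1) = f (k + 1) - T * f k := by
      intro k
      simp only [hf, gaussBinom_succ_succ, Nat.choose_succ_succ' k 1, Nat.choose_one_right]
      ring
    have shift : ∑ k ∈ Finset.range (n + 1), f (k + 1) + 1 = qPoch (T * p) p n := by
      have := Finset.sum_range_succ' f (n + 1)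
      rw [Finset.sum_range_succ, ih] at this
      simpa [hf, gaussBinom_eq_zero p n.lt_succ_self] using this.symm
    rw [Finset.sum_range_succ', Finset.sum_congr rfl fun k _ => pascal k, Finset.sum_sub_distrib,
      ← Finset.mul_sum, ih, qPoch_succ_left]
    simp only [pow_zero, Nat.choose_zero_succ, gaussBinom_zero_right, mul_one]
    linear_combination shift

-- The factor `(1 - eβpˣ)(1 - apˣs)` that is new in the step from `x` to `x + 1` is split, in the
-- `j`-th term, into `p^{x-j}(β - ap^j)(s - ep^j)` and `(1 - eap^{x+j})(1 - βp^{x-j}s)`.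
lemma qPoch_mul_qPoch_eq_sum (p a β e s : ℝ) (x : ℕ) :
    qPoch (e * β) p x * qPoch (a * s) p x = ∑ j ∈ Finset.range (x + 1),
      gaussBinom p x j * qSubPow β a p j * qSubPow s e p j
        * (qPoch (e * a * p ^ j) p (x - j) * qPoch (β * s) p (x - j)) := by
  induction x with
  | zero => simp
  | succ x ih =>
    set f : ℕ → ℝ := fun j => gaussBinom p x j * qSubPow β a p j * qSubPow s e p j
      * (qPoch (e * a * p ^ j) p (x - j) * qPoch (β * s) p (x - j)) with hf
    set up : ℕ → ℝ := fun j => f j * (p ^ (x - j) * (β - a * p ^ j) * (s - e * p ^ j)) with hup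
    set stay : ℕ → ℝ := fun j =>
      f j * ((1 - e * a * p ^ (x + j)) * (1 - β * p ^ (x - j) * s)) with hstay
    have split : ∀ j ∈ Finset.range (x + 1),
        f j * ((1 - e * β * p ^ x) * (1 - a * s * p ^ x)) = up j + stay j := by
      intro j hj
      obtain ⟨d, rfl⟩ := Nat.exists_eq_add_of_le (Finset.mem_range_succ_iff.1 hj)
      simp only [hup, hstay, Nat.add_sub_cancel_left]
      ring
    have stay_shift : ∑ j ∈ Finset.range (x + 1), stay j
        = ∑ j ∈ Finset.range (x + 1), stay (j + 1) + stay 0 := by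
      rw [← Finset.sum_range_succ', Finset.sum_range_succ stay (x + 1)]
      simp [hstay, hf, gaussBinom_eq_zero p x.lt_succ_self]
    have recombine : ∀ j ∈ Finset.range (x + 1), up j + stay (j + 1) =
        gaussBinom p (x + 1) (j + 1) * qSubPow β a p (j + 1) * qSubPow s e p (j + 1)
          * (qPoch (e * a * p ^ (j + 1)) p (x - j) * qPoch (β * s) p (x - j)) := by
      intro j hj
      rcases (Finset.mem_range_succ_iff.1 hj).eq_or_lt with rfl | hlt
      · simp [hup, hstay, hf, gaussBinom_eq_zero, qSubPow_succ]
        ring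
      · obtain ⟨d, rfl⟩ : ∃ d, x = j + 1 + d := Nat.exists_eq_add_of_le hlt
        have absorb := gaussBinom_succ_right_mul p (n := j + 1 + d) (k := j) (by omega)
        simp only [hup, hstay, hf, gaussBinom_succ_succ, qSubPow_succ,
          show j + 1 + d - j = d + 1 by omega, show j + 1 + d - (j + 1) = d by omega] at absorb ⊢
        rw [qPoch_succ_left (e * a * p ^ j), mul_assoc (e * a), ← pow_succ p j,
          qPoch_succ (e * a * p ^ (j + 1)), qPoch_succ (β * s)]
        linear_combination (qSubPow β a p j * (β - a * p ^ j) * (qSubPow s e p j * (s - e * p ^ j))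
          * qPoch (e * a * p ^ (j + 1)) p d * (qPoch (β * s) p d * (1 - β * s * p ^ d))) * absorb
    rw [qPoch_succ, qPoch_succ, mul_mul_mul_comm, ih, Finset.sum_mul, Finset.sum_congr rfl split,
      Finset.sum_add_distrib, stay_shift, ← add_assoc, ← Finset.sum_add_distrib,
      Finset.sum_congr rfl recombine, Finset.sum_range_succ' _ (x + 1)]
    simp only [Nat.add_sub_add_right]
    simp [hstay, hf, qPoch_succ]
    ring

/-! ### `q`-Krawtchouk generating functions -/

lemma qPoch_inv_pow_mul_div {p : ℝ} (hp : 0 < p) (hp1 : p ≠ 1) (n x N j : ℕ) :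
    qPoch (p ^ n)⁻¹ p j * qPoch (p ^ x)⁻¹ p j / (qPoch (p ^ N)⁻¹ p j * qPoch p p j)
      = (-1) ^ j * p ^ j.choose 2 * (p ^ (N * j) / (p ^ (n * j) * p ^ (x * j)))
        * (gaussBinom p n j * gaussBinom p x j / gaussBinom p N j) := by
  have hj := qPoch_self_ne_zero hp hp1 j
  rw [qPoch_inv_pow hp.ne', qPoch_inv_pow hp.ne', qPoch_inv_pow hp.ne']
  rcases eq_or_ne (gaussBinom p N j) 0 with hN | hN
  · simp [hN]
  · have sign : ((-1 : ℝ) ^ j) ≠ 0 := pow_ne_zero _ (by norm_num)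
    field_simp

lemma qKrawtchouk_eq_sum {p : ℝ} (hp : 0 < p) (hp1 : p ≠ 1) (n x N : ℕ) (c : ℝ) :
    qKrawtchouk n x c N p = ∑ j ∈ Finset.range (x + 1),
      (-1) ^ j * p ^ j.choose 2 * (p ^ (N * j) / (p ^ (n * j) * p ^ (x * j)))
        * (gaussBinom p n j * gaussBinom p x j / gaussBinom p N j)
        * qPoch (-c * p ^ x / p ^ N) p j * p ^ j := by
  have inv_cast : ∀ k : ℕ, p ^ (-(k : ℝ)) = (p ^ k)⁻¹ := fun k => by
    rw [Real.rpow_neg hp.le, Real.rpow_natCast]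
  have third : -c * p ^ ((x : ℝ) - N) = -c * p ^ x / p ^ N := by
    rw [Real.rpow_sub hp, Real.rpow_natCast, Real.rpow_natCast, mul_div_assoc]
  have qPoch_zero_left : ∀ j, qPoch 0 p j = 1 := fun j => by simp [qPoch]
  rw [qKrawtchouk, qHyp, tsum_eq_sum (s := Finset.range (x + 1))]
  · refine Finset.sum_congr rfl fun j _ => ?_
    rw [← qPoch_inv_pow_mul_div hp hp1]
    simp only [List.map_cons, List.map_nil, List.prod_cons, List.prod_nil, inv_cast, third,
      qPoch_zero_left]
    ring
  · intro j hj
    have hxj : x < j := by simpa [Nat.lt_succ_iff] using hj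
    simp [inv_cast, qPoch_inv_pow hp.ne' x, gaussBinom_eq_zero p hxj]

lemma add_choose_two (j m : ℕ) : (j + m).choose 2 = j.choose 2 + m.choose 2 + j * m := by
  induction m with
  | zero => simp
  | succ m ih =>
    rw [← add_assoc, Nat.choose_succ_succ' (j + m) 1, Nat.choose_succ_succ' m 1, ih]
    simp only [Nat.choose_one_right]
    ring

lemma sq_eq_two_mul_choose_two_add (j : ℕ) : j * j = 2 * j.choose 2 + j := by
  induction j with
  | zero => rfl
  | succ j ih =>
    rw [Nat.choose_succ_succ' j 1, Nat.choose_one_right]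
    linarith

lemma sum_gaussBinom_mul_gaussBinom_mul_pow {p : ℝ} (hp : 0 < p) (hp1 : p ≠ 1) (T : ℝ)
    (j l : ℕ) :
    ∑ n ∈ Finset.range (j + l + 1), (-1) ^ n * p ^ n.choose 2 * gaussBinom p (j + l) n
        * (gaussBinom p n j / p ^ (n * j)) * T ^ n
      = (-1) ^ j * p ^ j.choose 2 / p ^ (j * j) * gaussBinom p (j + l) j * T ^ j
        * qPoch T p l := by
  rw [add_assoc, Finset.sum_range_add, Finset.sum_eq_zero, zero_add, ← sum_gaussBinom_mul_pow,
    Finset.mul_sum]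
  · refine Finset.sum_congr rfl fun m hm => ?_
    obtain ⟨i, rfl⟩ := Nat.exists_eq_add_of_le (Finset.mem_range_succ_iff.1 hm)
    have subset := gaussBinom_mul_gaussBinom hp hp1 j m i
    have choose_add := add_choose_two j m
    rw [← add_assoc, choose_add, show (j + m) * j = j * j + j * m by ring]
    simp only [pow_add]
    field_simp
    linear_combination T ^ j * T ^ m * subset
  · intro n hn
    simp [gaussBinom_eq_zero p (Finset.mem_range.1 hn)]

lemma sum_gaussBinom_mul_qKrawtchouk {p : ℝ} (hp : 0 < p) (hp1 : p ≠ 1) (c T : ℝ) {x N : ℕ}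
    (hx : x ≤ N) :
    ∑ n ∈ Finset.range (N + 1), (-1) ^ n * p ^ n.choose 2 * gaussBinom p N n
        * qKrawtchouk n x c N p * T ^ n
      = qPoch (-c * T) p x * qPoch T p (N - x) := by
  obtain ⟨d, rfl⟩ := Nat.exists_eq_add_of_le hx
  have expand := qPoch_mul_qPoch_eq_sum p (-c) (p ^ d) 0 T x
  have e₀ : qPoch (0 * p ^ d) p x = 1 := by simp [qPoch]
  rw [e₀, one_mul] at expand
  rw [expand, Nat.add_sub_cancel_left, Finset.sum_mul]
  simp only [qKrawtchouk_eq_sum hp hp1, Finset.mul_sum, Finset.sum_mul]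
  rw [Finset.sum_comm]
  refine Finset.sum_congr rfl fun j hj => ?_
  obtain ⟨i, rfl⟩ := Nat.exists_eq_add_of_le (Finset.mem_range_succ_iff.1 hj)
  have inner := sum_gaussBinom_mul_gaussBinom_mul_pow hp hp1 T j (i + d)
  have hpos : gaussBinom p (j + i + d) j ≠ 0 := (gaussBinom_pos hp (by omega)).ne'
  have base_arg : -c * p ^ (j + i) / p ^ (j + i + d) = -c / p ^ d := by
    rw [pow_add p (j + i) d]
    field_simp
  have sub_pow : qSubPow (p ^ d) (-c) p j = (p ^ d) ^ j * qPoch (-c / p ^ d) p j := by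
    rw [← qSubPow_mul_left, mul_div_cancel₀ _ (pow_ne_zero d hp.ne')]
  have split : qPoch T p (i + d) = qPoch T p d * qPoch (p ^ d * T) p i := by
    rw [add_comm i d, qPoch_add, mul_comm T]
  have zero_arg : qPoch (0 * -c * p ^ j) p i = 1 := by simp [qPoch]
  rw [qSubPow_zero_right, sub_pow, Nat.add_sub_cancel_left, zero_arg, one_mul]
  calc ∑ n ∈ Finset.range (j + i + d + 1), _
      = (-1) ^ j * p ^ j.choose 2 * (p ^ ((j + i + d) * j) / p ^ ((j + i) * j))
          * (gaussBinom p (j + i) j / gaussBinom p (j + i + d) j) * qPoch (-c / p ^ d) p j * p ^ j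
          * ∑ n ∈ Finset.range (j + (i + d) + 1), (-1) ^ n * p ^ n.choose 2
            * gaussBinom p (j + (i + d)) n * (gaussBinom p n j / p ^ (n * j)) * T ^ n := by
        rw [Finset.mul_sum, ← add_assoc]
        refine Finset.sum_congr rfl fun n _ => ?_
        rw [base_arg]
        field_simp
    _ = _ := by
        rw [inner, split, sq_eq_two_mul_choose_two_add, add_mul (j + i) d j,
          pow_add p ((j + i) * j), pow_add p _ j, two_mul, pow_add, ← add_assoc, ← pow_mul]
        field_simp
        rw [← pow_mul, mul_comm j 2, pow_mul, neg_one_sq, one_pow, one_mul]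

lemma qPoch_inv_base {p : ℝ} (hp : p ≠ 0) (a : ℝ) (n : ℕ) :
    qPoch (a * p ^ n) p⁻¹ n = qPoch (a * p) p n := by
  rw [qPoch, qPoch, ← Finset.prod_range_reflect]
  refine Finset.prod_congr rfl fun j hj => ?_
  obtain ⟨i, rfl⟩ := Nat.exists_eq_add_of_lt (Finset.mem_range.1 hj)
  rw [show j + i + 1 - 1 - j = i by omega, inv_pow, pow_succ, pow_add]
  field_simp

lemma qPoch_inv_base_self {p : ℝ} (hp : p ≠ 0) (n : ℕ) :
    qPoch p⁻¹ p⁻¹ n = (-1) ^ n / p ^ (n + 1).choose 2 * qPoch p p n := by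
  induction n with
  | zero => simp
  | succ n ih =>
    rw [qPoch_succ, ih, qPoch_succ, Nat.choose_succ_succ' (n + 1) 1, Nat.choose_one_right,
      pow_add p (n + 1), pow_succ (-1 : ℝ), ← pow_succ', ← pow_succ', inv_pow]
    field_simp
    ring

lemma sq_ne_one_of_pos {q : ℝ} (hq : 0 < q) (hq1 : q ≠ 1) : q ^ 2 ≠ 1 :=
  fun h => hq1 ((pow_eq_one_iff_of_nonneg hq.le two_ne_zero).1 h)

lemma wSite_inv {q : ℝ} (hq : 0 < q) (hq1 : q ≠ 1) {n N : ℕ} (h : n ≤ N) :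
    wSite n N q⁻¹ = wSite n N q := by
  obtain ⟨m, rfl⟩ := Nat.exists_eq_add_of_le h
  have hn := qPoch_self_ne_zero (pow_pos hq 2) (sq_ne_one_of_pos hq hq1) n
  have hm := qPoch_self_ne_zero (pow_pos hq 2) (sq_ne_one_of_pos hq hq1) m
  have exponent : (n : ℝ) * ((n : ℝ) - ((n + m : ℕ) : ℝ)) = -((n * m : ℕ) : ℝ) := by
    push_cast
    ring
  have hp : q ^ 2 ≠ 0 := by positivity
  rw [wSite, wSite, qBinom, qBinom, Nat.add_sub_cancel_left, inv_pow, qPoch_inv_base_self hp,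
    qPoch_inv_base_self hp, qPoch_inv_base_self hp, exponent, Real.inv_rpow hq.le,
    Real.rpow_neg hq.le, Real.rpow_natCast, show n + m + 1 = n + (m + 1) by ring,
    add_choose_two n (m + 1), Nat.choose_succ_succ' n 1, Nat.choose_one_right, pow_add (-1 : ℝ)]
  have sign : ∀ k : ℕ, ((-1 : ℝ) ^ k) ≠ 0 := fun k => pow_ne_zero _ (by norm_num)
  have := sign n
  have := sign m
  field_simp
  ring

lemma wSite_pos {q : ℝ} (hq : 0 < q) (hq1 : q ≠ 1) {n N : ℕ} (h : n ≤ N) : 0 < wSite n N q := by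
  have hp : 0 < q ^ 2 := by positivity
  rw [wSite, qBinom_eq_gaussBinom hp (sq_ne_one_of_pos hq hq1) h]
  have := gaussBinom_pos hp h
  positivity

lemma sq_pow_eq_rpow (q : ℝ) (n : ℕ) : (q ^ 2) ^ n = q ^ (2 * n : ℝ) := by
  rw [← pow_mul, ← Real.rpow_natCast]
  push_cast
  rfl

lemma sq_pow_choose_two (q : ℝ) (n : ℕ) : (q ^ 2) ^ n.choose 2 = q ^ ((n : ℝ) * (n - 1)) := by
  rw [sq_pow_eq_rpow, Nat.cast_choose_two]
  congr 1
  ring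

lemma sum_wSite_mul_kSite {q : ℝ} (hq : 0 < q) (hq1 : q ≠ 1) {x N : ℕ} (hx : x ≤ N) (ρ t : ℝ) :
    ∑ n ∈ Finset.range (N + 1), wSite n N q * kSite n x ρ N q * t ^ n
      = qPoch (-(q ^ (ρ + (1 - N) / 2) * t)) (q ^ 2) x
        * qPoch (q ^ (-ρ + (1 - N) / 2) * t) (q ^ 2) (N - x) := by
  have hp1 := sq_ne_one_of_pos hq hq1
  have arg : -q ^ (2 * ρ) * (q ^ (-ρ + (1 - N) / 2) * t) = -(q ^ (ρ + (1 - (N : ℝ)) / 2) * t) := by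
    rw [neg_mul, ← mul_assoc, ← Real.rpow_add hq]
    congr 3
    ring
  rw [← arg, ← sum_gaussBinom_mul_qKrawtchouk (pow_pos hq 2) hp1 _ _ hx]
  refine Finset.sum_congr rfl fun n hn => ?_
  have powers : q ^ ((n : ℝ) * (n - N)) * (q ^ (-((n : ℝ) * ρ)) * q ^ ((n : ℝ) * (N - 1) / 2))
      = (q ^ 2) ^ n.choose 2 * (q ^ (-ρ + (1 - (N : ℝ)) / 2)) ^ n := by
    rw [sq_pow_choose_two, ← Real.rpow_mul_natCast hq.le]
    simp only [← Real.rpow_add hq]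
    congr 1
    ring
  rw [wSite, kSite, qBinom_eq_gaussBinom (pow_pos hq 2) hp1 (Finset.mem_range_succ_iff.1 hn),
    mul_pow]
  linear_combination ((-1) ^ n * gaussBinom (q ^ 2) N n
    * qKrawtchouk n x (q ^ (2 * ρ)) N (q ^ 2) * t ^ n) * powers

/-! ### A closed pairing for `q`-shifted factorials -/

open Polynomial in
/-- The `q`-shifted factorial `(bX;p)_n` as a polynomial. -/
def qPochPoly (b p : ℝ) (n : ℕ) : ℝ[X] := ∏ i ∈ Finset.range n, (1 - C (b * p ^ i) * X)

open Polynomial in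
/-- The homogeneous `q`-shifted factorial `(X - e)^n_p` as a polynomial. -/
def qSubPowPoly (e p : ℝ) (n : ℕ) : ℝ[X] := ∏ i ∈ Finset.range n, (X - C (e * p ^ i))

section Pairing

open Polynomial

@[simp] lemma eval_qPochPoly (b p s : ℝ) (n : ℕ) :
    (qPochPoly b p n).eval s = qPoch (b * s) p n := by
  simp [qPochPoly, qPoch, eval_prod, mul_right_comm]

@[simp] lemma eval_qSubPowPoly (e p s : ℝ) (n : ℕ) :
    (qSubPowPoly e p n).eval s = qSubPow s e p n := by
  simp [qSubPowPoly, qSubPow, eval_prod]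

lemma qPochPoly_eq_sum (b p : ℝ) (n : ℕ) : qPochPoly b p n = ∑ k ∈ Finset.range (n + 1),
    ((-1) ^ k * p ^ k.choose 2 * gaussBinom p n k * b ^ k) • X ^ k := by
  refine Polynomial.funext fun s => ?_
  rw [eval_qPochPoly, ← sum_gaussBinom_mul_pow, eval_finsetSum]
  refine Finset.sum_congr rfl fun k _ => ?_
  simp only [eval_smul, eval_pow, eval_X, smul_eq_mul]
  ring

lemma qSubPowPoly_mul_qPochPoly_succ (p b e : ℝ) {N j : ℕ} (hj : j < N) :
    (b * (1 - p ^ (N - j))) • (qSubPowPoly e p (j + 1) * qPochPoly (b * p) p (N - (j + 1)))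
      = (1 - b * e * p ^ j) • (qSubPowPoly e p j * qPochPoly (b * p) p (N - j))
        - (1 - b * e * p ^ N) • (qSubPowPoly e p j * qPochPoly b p (N - j)) := by
  obtain ⟨d, rfl⟩ : ∃ d, N = j + 1 + d := Nat.exists_eq_add_of_le hj
  refine Polynomial.funext fun s => ?_
  simp only [eval_smul, eval_sub, eval_mul, eval_qPochPoly, eval_qSubPowPoly, smul_eq_mul,
    show j + 1 + d - j = d + 1 by omega, Nat.add_sub_cancel_left, qSubPow_succ]
  rw [qPoch_succ_left (b * s), show b * s * p = b * p * s by ring, qPoch_succ]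
  ring

lemma gaussBinom_mul_qSubPow_mul_qPoch_succ (p b c e : ℝ) (y j : ℕ) :
    b * (1 - p ^ (j + 1))
        * (gaussBinom p y (j + 1) * qSubPow c e p (j + 1) * qPoch (c * (b * p)) p (y - (j + 1)))
      = gaussBinom p y j * qSubPow c e p j
        * ((1 - b * e * p ^ j) * qPoch (c * (b * p)) p (y - j)
          - (1 - b * e * p ^ y) * qPoch (c * b) p (y - j)) := by
  rcases lt_trichotomy y j with hlt | rfl | hgt
  · simp [gaussBinom_eq_zero p hlt, gaussBinom_eq_zero p (hlt.trans j.lt_succ_self)]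
  · simp [gaussBinom_eq_zero]
  · obtain ⟨d, rfl⟩ : ∃ d, y = j + 1 + d := Nat.exists_eq_add_of_le hgt
    have absorb := gaussBinom_succ_right_mul p (n := j + 1 + d) (k := j) (by omega)
    rw [show j + 1 + d - j = d + 1 by omega] at absorb ⊢
    rw [Nat.add_sub_cancel_left, qSubPow_succ, qPoch_succ_left (c * b), mul_assoc c b p, qPoch_succ]
    linear_combination b * qSubPow c e p j * (c - e * p ^ j) * qPoch (c * (b * p)) p d * absorb

variable {p c e : ℝ} {y N : ℕ} {E : ℝ[X] →ₗ[ℝ] ℝ}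

-- The left factors `(X - e)^j_p` are adapted to the argument `e * p ^ y` in `hE`: it makes the
-- right-hand side a single product.
lemma pairing_qSubPowPoly_mul_qPochPoly (hp : 0 < p) (hp1 : p ≠ 1) (hy : y ≤ N)
    (hE : ∀ b, E (qPochPoly b p N) = qPoch (c * b) p y * qPoch (e * p ^ y * b) p (N - y))
    {j : ℕ} (hj : j ≤ N) {b : ℝ} (hb : b ≠ 0) :
    gaussBinom p N j * E (qSubPowPoly e p j * qPochPoly b p (N - j))
      = gaussBinom p y j * qSubPow c e p j * qPoch (c * b) p (y - j)
        * qPoch (e * p ^ y * b) p (N - y) := by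
  induction j generalizing b with
  | zero => simp [qSubPowPoly, hE]
  | succ j ih =>
    obtain ⟨b, rfl⟩ : ∃ b', b = b' * p := ⟨b / p, (div_mul_cancel₀ b hp.ne').symm⟩
    have hb' : b ≠ 0 := left_ne_zero_of_mul hb
    have step := congrArg E (qSubPowPoly_mul_qPochPoly_succ p b e hj)
    simp only [map_sub, map_smul, smul_eq_mul] at step
    have closed := gaussBinom_mul_qSubPow_mul_qPoch_succ p b c e y j
    have absorb := gaussBinom_succ_right_mul p (n := N) (k := j) (by omega)
    have shift := qPoch_mul_base (e * p ^ y * b) p (N - y)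
    rw [mul_assoc _ b p] at shift
    have pow_N : p ^ N = p ^ y * p ^ (N - y) := by rw [← pow_add, Nat.add_sub_cancel' hy]
    refine mul_left_cancel₀ (mul_ne_zero hb' (one_sub_pow_ne_zero hp hp1 j)) ?_
    linear_combination b * E (qSubPowPoly e p (j + 1) * qPochPoly (b * p) p (N - (j + 1)))
        * absorb + gaussBinom p N j * step + (1 - b * e * p ^ j) * ih (by omega) hb
      - (1 - b * e * p ^ N) * ih (by omega) hb' - qPoch (e * p ^ y * (b * p)) p (N - y) * closed
      + gaussBinom p y j * qSubPow c e p j * qPoch (c * b) p (y - j) * shift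
      + b * e * gaussBinom p y j * qSubPow c e p j * qPoch (c * b) p (y - j)
        * qPoch (e * p ^ y * b) p (N - y) * pow_N

lemma qPoch_mul_pairing (hp : 0 < p) (hp1 : p ≠ 1) (hy : y ≤ N)
    (hE : ∀ b, E (qPochPoly b p N) = qPoch (c * b) p y * qPoch (e * p ^ y * b) p (N - y))
    (a : ℝ) {b : ℝ} (hb : b ≠ 0) {x : ℕ} (hx : x ≤ N) :
    qPoch (e * b * p ^ (N - x)) p x * E (qPochPoly a p x * qPochPoly b p (N - x))
      = ∑ j ∈ Finset.range (x + 1), gaussBinom p x j * gaussBinom p y j / gaussBinom p N j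
        * qSubPow (b * p ^ (N - x)) a p j * qPoch (e * a * p ^ j) p (x - j)
        * (qSubPow c e p j * qPoch (c * b) p (y - j)) * qPoch (e * p ^ y * b) p (N - y) := by
  have expand : qPoch (e * b * p ^ (N - x)) p x • (qPochPoly a p x * qPochPoly b p (N - x))
      = ∑ j ∈ Finset.range (x + 1), (gaussBinom p x j * qSubPow (b * p ^ (N - x)) a p j
        * qPoch (e * a * p ^ j) p (x - j)) • (qSubPowPoly e p j * qPochPoly b p (N - j)) := by
    refine Polynomial.funext fun s => ?_
    have vandermonde := qPoch_mul_qPoch_eq_sum p a (b * p ^ (N - x)) e s x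
    simp only [eval_smul, eval_finsetSum, eval_mul, eval_qPochPoly, eval_qSubPowPoly, smul_eq_mul]
    rw [← mul_assoc, mul_assoc e, vandermonde, Finset.sum_mul]
    refine Finset.sum_congr rfl fun j hj => ?_
    have hjx := Finset.mem_range_succ_iff.1 hj
    rw [show N - j = N - x + (x - j) by omega, qPoch_add (b * s), mul_right_comm b s]
    ring
  have image := congrArg E expand
  rw [map_smul, smul_eq_mul, map_sum] at image
  rw [image]
  refine Finset.sum_congr rfl fun j hj => ?_
  have hjN : j ≤ N := (Finset.mem_range_succ_iff.1 hj).trans hx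
  have closed := pairing_qSubPowPoly_mul_qPochPoly hp hp1 hy hE hjN hb
  rw [map_smul, smul_eq_mul,
    eq_div_of_mul_eq (gaussBinom_pos hp hjN).ne' ((mul_comm _ _).trans closed)]
  ring

end Pairing

/-! ### The `q`-Racah form of the one-site duality functions -/

lemma qRacah_eq_sum {p : ℝ} (hp : 0 < p) (hp1 : p ≠ 1) {γ : ℝ} {N : ℕ} (hγ : γ * p = (p ^ N)⁻¹)
    (x y : ℕ) (α β δ : ℝ) :
    qRacah x y α β γ δ p = ∑ j ∈ Finset.range (x + 1),
      (-1) ^ j * p ^ j.choose 2 * (p ^ (N * j) / (p ^ (x * j) * p ^ (y * j)))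
        * (gaussBinom p x j * gaussBinom p y j / gaussBinom p N j)
        * (qPoch (α * β * p ^ (x + 1)) p j * qPoch (γ * δ * p ^ (y + 1)) p j
          / (qPoch (α * p) p j * qPoch (β * δ * p) p j)) * p ^ j := by
  have inv_cast : ∀ k : ℕ, p ^ (-(k : ℝ)) = (p ^ k)⁻¹ := fun k => by
    rw [Real.rpow_neg hp.le, Real.rpow_natCast]
  have succ_cast : ∀ k : ℕ, p ^ ((k : ℝ) + 1) = p ^ (k + 1) := fun k => by
    rw [← Nat.cast_succ, Real.rpow_natCast]
  rw [qRacah, qHyp, tsum_eq_sum (s := Finset.range (x + 1))]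
  · refine Finset.sum_congr rfl fun j _ => ?_
    rw [← qPoch_inv_pow_mul_div hp hp1]
    simp only [List.map_cons, List.map_nil, List.prod_cons, List.prod_nil, inv_cast, succ_cast, hγ]
    ring
  · intro j hj
    have hxj : x < j := by simpa [Nat.lt_succ_iff] using hj
    simp [inv_cast, qPoch_inv_pow hp.ne' x, gaussBinom_eq_zero p hxj]

lemma qPoch_reverse {p : ℝ} (hp : p ≠ 0) {n : ℕ} {a b : ℝ} (h : a * b * p ^ n = p) :
    qPoch b p n = (-b) ^ n * p ^ n.choose 2 * qPoch a p n := by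
  induction n generalizing a with
  | zero => simp
  | succ n ih =>
    have top : a * b * p ^ n = 1 := mul_right_cancel₀ hp (by rw [one_mul, mul_assoc, ← pow_succ, h])
    rw [qPoch_succ, qPoch_succ_left a, ih (a := a * p) (by linear_combination p * top),
      Nat.choose_succ_succ' n 1, Nat.choose_one_right, pow_add p n, pow_succ (-b) n]
    linear_combination -((-b) ^ n * p ^ n.choose 2 * qPoch (a * p) p n) * top

lemma qPoch_ne_zero_of_le {a p : ℝ} {m n : ℕ} (hmn : m ≤ n) (h : qPoch a p n ≠ 0) :
    qPoch a p m ≠ 0 := by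
  obtain ⟨k, rfl⟩ := Nat.exists_eq_add_of_le hmn
  rw [qPoch_add] at h
  exact left_ne_zero_of_mul h

lemma qRacah_term_coeff {p : ℝ} (hp : p ≠ 0) (b c : ℝ) (j k i l : ℕ) :
    (b * p ^ l) ^ j * c ^ j * ((-(c * b)) ^ i * p ^ i.choose 2)
      = (-1) ^ j * p ^ j.choose 2
        * (p ^ ((j + k + l) * j) / (p ^ ((j + k) * j) * p ^ ((j + i) * j)))
        * p ^ j * ((-(c * b)) ^ (j + i) * p ^ (j + i).choose 2) := by
  have sign : (-1 : ℝ) ^ j * (-1) ^ j = 1 := by rw [← mul_pow]; norm_num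
  have square : p ^ (j * j) = p ^ j.choose 2 * p ^ j.choose 2 * p ^ j := by
    rw [sq_eq_two_mul_choose_two_add, pow_add, two_mul, pow_add]
  rw [add_choose_two]
  simp only [add_mul, pow_add, neg_pow (c * b), mul_pow, square, mul_comm i j, ← pow_mul]
  field_simp
  linear_combination -(b ^ j * b ^ i * c ^ j * c ^ i) * sign

open Polynomial in
lemma qPoch_mul_pairing_eq_qRacah {p : ℝ} (hp : 0 < p) (hp1 : p ≠ 1) {x y N : ℕ} (hx : x ≤ N)
    (hy : y ≤ N) {E : ℝ[X] →ₗ[ℝ] ℝ} {a b c e α β γ δ : ℝ}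
    (hE : ∀ b, E (qPochPoly b p N) = qPoch (c * b) p y * qPoch (e * p ^ y * b) p (N - y))
    (hγ : γ * p = (p ^ N)⁻¹) (hα : α * (c * b) * p ^ y = 1) (ha : a = b * (α * β * p ^ (N + 1)))
    (he : e = c * (γ * δ * p ^ (y + 1)))
    (hαj : qPoch (α * p) p (min x y) ≠ 0) (hβδj : qPoch (β * δ * p) p (min x y) ≠ 0) :
    qPoch (e * b * p ^ (N - x)) p x * E (qPochPoly a p x * qPochPoly b p (N - x))
      = (-(c * b)) ^ y * p ^ y.choose 2 * qPoch (α * p) p y * qPoch (β * δ * p) p x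
        * qPoch (e * p ^ y * b) p (N - y) * qRacah x y α β γ δ p := by
  have hb : b ≠ 0 := by
    rintro rfl
    simp at hα
  have eα : e * a = β * δ * p := by
    have hγN : γ * p * p ^ N = 1 := by rw [hγ, inv_mul_cancel₀ (pow_ne_zero N hp.ne')]
    rw [he, ha]
    linear_combination (c * b * α * p ^ y) * β * δ * p * hγN + β * δ * p * hα
  rw [qPoch_mul_pairing hp hp1 hy hE a hb hx, qRacah_eq_sum hp hp1 hγ, Finset.mul_sum]
  refine Finset.sum_congr rfl fun j hj => ?_
  obtain ⟨k, rfl⟩ := Nat.exists_eq_add_of_le (Finset.mem_range_succ_iff.1 hj)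
  rcases lt_or_ge y j with hyj | hjy
  · simp [gaussBinom_eq_zero p hyj]
  obtain ⟨i, rfl⟩ := Nat.exists_eq_add_of_le hjy
  obtain ⟨l, rfl⟩ := Nat.exists_eq_add_of_le hx
  have hα_ne := qPoch_ne_zero_of_le (le_min (Nat.le_add_right j k) hjy) hαj
  have hβδ_ne := qPoch_ne_zero_of_le (le_min (Nat.le_add_right j k) hjy) hβδj
  have left_factor : qSubPow (b * p ^ l) a p j
      = (b * p ^ l) ^ j * qPoch (α * β * p ^ (j + k + 1)) p j := by
    rw [← qSubPow_mul_left, ha]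
    ring_nf
  have right_factor : qSubPow c e p j = c ^ j * qPoch (γ * δ * p ^ (j + i + 1)) p j := by
    rw [← qSubPow_mul_left, he]
  have reversed : qPoch (c * b) p i
      = (-(c * b)) ^ i * p ^ i.choose 2 * qPoch (α * p * p ^ j) p i :=
    qPoch_reverse hp.ne' (by linear_combination p * hα)
  have scalars := qRacah_term_coeff hp.ne' b c j k i l
  have cancel : qPoch (α * p) p j * qPoch (β * δ * p) p j * (_ / _) = _ := mul_div_cancel₀
    (qPoch (α * β * p ^ (j + k + 1)) p j * qPoch (γ * δ * p ^ (j + i + 1)) p j)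
    (mul_ne_zero hα_ne hβδ_ne)
  simp only [Nat.add_sub_cancel_left, eα]
  rw [left_factor, right_factor, reversed, qPoch_add (α * p) p j i, qPoch_add (β * δ * p) p j k]
  set G := gaussBinom p (j + k) j * gaussBinom p (j + i) j / gaussBinom p (j + k + l) j
  linear_combination G * qPoch (α * β * p ^ (j + k + 1)) p j * qPoch (γ * δ * p ^ (j + i + 1)) p j
    * qPoch (β * δ * p * p ^ j) p k * qPoch (α * p * p ^ j) p i
    * qPoch (e * p ^ (j + i) * b) p (j + k + l - (j + i)) * scalars
    - G * qPoch (β * δ * p * p ^ j) p k * qPoch (α * p * p ^ j) p i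
    * qPoch (e * p ^ (j + i) * b) p (j + k + l - (j + i))
    * ((-1) ^ j * p ^ j.choose 2 * (p ^ ((j + k + l) * j) / (p ^ ((j + k) * j) * p ^ ((j + i) * j)))
        * p ^ j * ((-(c * b)) ^ (j + i) * p ^ (j + i).choose 2)) * cancel

/-- The one-site factor of `R^v`. -/
def rvSite (y x : ℕ) (lam ρ v : ℝ) (N : ℕ) (q : ℝ) : ℝ :=
  ∑ n ∈ Finset.range (N + 1),
    kSite n y lam N q⁻¹ * kSite n x ρ N q * wSite n N q * (-v) ^ n

section OneSite

open Polynomial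

/-- The linear functional on real polynomials with moments `μ n`. -/
def momentFunctional (μ : ℕ → ℝ) : ℝ[X] →ₗ[ℝ] ℝ := lsum fun n => μ n • LinearMap.id

lemma momentFunctional_X_pow (μ : ℕ → ℝ) (n : ℕ) : momentFunctional μ (X ^ n) = μ n := by
  rw [← monomial_one_right_eq_X_pow]
  simp [momentFunctional, lsum_apply, sum_monomial_index]

variable {q : ℝ} {x y N : ℕ}

lemma qPochPoly_mul_qPochPoly_eq_sum (hq : 0 < q) (hq1 : q ≠ 1) (hx : x ≤ N) (ρ : ℝ) :
    qPochPoly (-q ^ (ρ + (1 - N) / 2)) (q ^ 2) x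
        * qPochPoly (q ^ (-ρ + (1 - N) / 2)) (q ^ 2) (N - x)
      = ∑ n ∈ Finset.range (N + 1), (wSite n N q * kSite n x ρ N q) • X ^ n := by
  refine Polynomial.funext fun t => ?_
  simp only [eval_mul, eval_qPochPoly, eval_finsetSum, eval_smul, eval_pow, eval_X, smul_eq_mul,
    neg_mul, sum_wSite_mul_kSite hq hq1 hx]

lemma sum_wSite_mul_kSite_inv (hq : 0 < q) (hq1 : q ≠ 1) (hy : y ≤ N) (lam t : ℝ) :
    ∑ n ∈ Finset.range (N + 1), wSite n N q * kSite n y lam N q⁻¹ * (t * q ^ (N - 1 : ℝ)) ^ n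
      = qPoch (-(q ^ (-lam + (3 * N + 1) / 2 - 2 * y) * t)) (q ^ 2) y
        * qPoch (q ^ (lam + (1 - N) / 2) * (q ^ 2) ^ y * t) (q ^ 2) (N - y) := by
  have hq2 : q ^ 2 ≠ 0 := (pow_pos hq 2).ne'
  have gf := sum_wSite_mul_kSite (inv_pos.2 hq) (inv_ne_one.2 hq1) hy lam (t * q ^ (N - 1 : ℝ))
  have arg_y : -(q⁻¹ ^ (lam + (1 - (N : ℝ)) / 2) * (t * q ^ (N - 1 : ℝ)))
      = -(q ^ (-lam + (3 * N + 1) / 2 - 2 * y) * t) / q ^ 2 * (q ^ 2) ^ y := by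
    have exponents : q ^ (-(lam + (1 - (N : ℝ)) / 2)) * q ^ (N - 1 : ℝ) * q ^ (2 : ℝ)
        = q ^ (-lam + (3 * N + 1) / 2 - 2 * y : ℝ) * q ^ (2 * y : ℝ) := by
      simp only [← Real.rpow_add hq]
      ring_nf
    rw [Real.inv_rpow hq.le, ← Real.rpow_neg hq.le, sq_pow_eq_rpow, div_mul_eq_mul_div,
      eq_div_iff hq2, ← Real.rpow_two]
    linear_combination -t * exponents
  have arg_N_sub_y : q⁻¹ ^ (-lam + (1 - (N : ℝ)) / 2) * (t * q ^ (N - 1 : ℝ))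
      = q ^ (lam + (1 - N) / 2) * (q ^ 2) ^ y * t / q ^ 2 * (q ^ 2) ^ (N - y) := by
    have exponents : q ^ (-(-lam + (1 - (N : ℝ)) / 2)) * q ^ (N - 1 : ℝ) * q ^ (2 : ℝ)
        = q ^ (lam + (1 - N) / 2) * q ^ (2 * N : ℝ) := by
      simp only [← Real.rpow_add hq]
      ring_nf
    rw [Real.inv_rpow hq.le, ← Real.rpow_neg hq.le, div_mul_eq_mul_div, mul_right_comm _ t,
      mul_assoc (q ^ (lam + _)), ← pow_add, Nat.add_sub_cancel' hy, sq_pow_eq_rpow,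
      eq_div_iff hq2, ← Real.rpow_two]
    linear_combination t * exponents
  rw [arg_y, arg_N_sub_y, inv_pow, qPoch_inv_base hq2, qPoch_inv_base hq2,
    div_mul_cancel₀ _ hq2, div_mul_cancel₀ _ hq2] at gf
  rw [← gf]
  exact Finset.sum_congr rfl fun n hn => by
    rw [wSite_inv hq hq1 (Finset.mem_range_succ_iff.1 hn)]

lemma momentFunctional_qPochPoly (hq : 0 < q) (hq1 : q ≠ 1) (hy : y ≤ N) (lam v b : ℝ) :
    momentFunctional (fun n => kSite n y lam N q⁻¹ * (-v) ^ n) (qPochPoly b (q ^ 2) N)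
      = qPoch (-v * q ^ (-lam + (3 * N + 1) / 2 - 2 * y) * b) (q ^ 2) y
        * qPoch (v * q ^ (lam + (1 - N) / 2) * (q ^ 2) ^ y * b) (q ^ 2) (N - y) := by
  have gf := sum_wSite_mul_kSite_inv hq hq1 hy lam (v * b)
  rw [show -v * q ^ (-lam + (3 * N + 1) / 2 - 2 * y : ℝ) * b
      = -(q ^ (-lam + (3 * N + 1) / 2 - 2 * y : ℝ) * (v * b)) by ring,
    show v * q ^ (lam + (1 - N) / 2 : ℝ) * (q ^ 2) ^ y * b
      = q ^ (lam + (1 - N) / 2 : ℝ) * (q ^ 2) ^ y * (v * b) by ring, ← gf,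
    qPochPoly_eq_sum, map_sum]
  refine Finset.sum_congr rfl fun n hn => ?_
  have powers : q ^ ((n : ℝ) * (n - N)) * (q ^ (N - 1 : ℝ)) ^ n = (q ^ 2) ^ n.choose 2 := by
    rw [sq_pow_choose_two, ← Real.rpow_mul_natCast hq.le, ← Real.rpow_add hq]
    ring_nf
  have sign : (-1 : ℝ) ^ n * (-1) ^ n = 1 := by rw [← mul_pow]; norm_num
  rw [map_smul, momentFunctional_X_pow, wSite, qBinom_eq_gaussBinom (pow_pos hq 2)
    (sq_ne_one_of_pos hq hq1) (Finset.mem_range_succ_iff.1 hn), ← powers, smul_eq_mul, neg_pow v]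
  simp only [mul_pow]
  linear_combination (q ^ ((n : ℝ) * (n - N)) * (q ^ (N - 1 : ℝ)) ^ n * gaussBinom (q ^ 2) N n
    * b ^ n * kSite n y lam N q⁻¹ * v ^ n) * sign

lemma rvSite_eq_momentFunctional (hq : 0 < q) (hq1 : q ≠ 1) (hx : x ≤ N) (lam ρ v : ℝ) :
    rvSite y x lam ρ v N q = momentFunctional (fun n => kSite n y lam N q⁻¹ * (-v) ^ n)
      (qPochPoly (-q ^ (ρ + (1 - N) / 2)) (q ^ 2) x
        * qPochPoly (q ^ (-ρ + (1 - N) / 2)) (q ^ 2) (N - x)) := by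
  rw [qPochPoly_mul_qPochPoly_eq_sum hq hq1 hx, map_sum]
  refine Finset.sum_congr rfl fun n _ => ?_
  rw [map_smul, momentFunctional_X_pow, smul_eq_mul]
  ring

-- The hypotheses of `qPoch_mul_pairing_eq_qRacah` in base `q ^ 2`, for the parameters of `rSite`.
lemma rSite_parameters (hq : 0 < q) (y N : ℕ) (lam ρ : ℝ) {v : ℝ} (hv : v ≠ 0) :
    q ^ (-2 * (N : ℝ) - 2) * q ^ 2 = ((q ^ 2) ^ N)⁻¹
    ∧ -v⁻¹ * q ^ (ρ + lam - N - 1)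
        * (-v * q ^ (-lam + (3 * (N : ℝ) + 1) / 2 - 2 * y) * q ^ (-ρ + (1 - (N : ℝ)) / 2))
        * (q ^ 2) ^ y = 1
    ∧ -q ^ (ρ + (1 - (N : ℝ)) / 2) = q ^ (-ρ + (1 - (N : ℝ)) / 2)
        * (-v⁻¹ * q ^ (ρ + lam - N - 1) * (v * q ^ (ρ - lam - N - 1)) * (q ^ 2) ^ (N + 1))
    ∧ v * q ^ (lam + (1 - (N : ℝ)) / 2) = -v * q ^ (-lam + (3 * (N : ℝ) + 1) / 2 - 2 * y)
        * (q ^ (-2 * (N : ℝ) - 2) * -q ^ (2 * lam) * (q ^ 2) ^ (y + 1)) := by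
  have hv' : v⁻¹ * v = 1 := inv_mul_cancel₀ hv
  simp only [sq_pow_eq_rpow]
  refine ⟨?_, ?_, ?_, ?_⟩
  · rw [← Real.rpow_neg hq.le, ← Real.rpow_add_natCast hq.ne']
    ring_nf
  · have exponents : q ^ (ρ + lam - N - 1) * q ^ (-lam + (3 * N + 1) / 2 - 2 * y)
        * q ^ (-ρ + (1 - (N : ℝ)) / 2) * q ^ (2 * y : ℝ) = 1 := by
      simp only [← Real.rpow_add hq]
      ring_nf
      exact Real.rpow_zero q
    linear_combination v⁻¹ * v * exponents + hv'
  · have exponents : q ^ (-ρ + (1 - (N : ℝ)) / 2) * q ^ (ρ + lam - N - 1)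
        * q ^ (ρ - lam - N - 1) * q ^ (2 * (N + 1 : ℕ) : ℝ) = q ^ (ρ + (1 - (N : ℝ)) / 2) := by
      simp only [← Real.rpow_add hq]
      push_cast
      ring_nf
    linear_combination v⁻¹ * v * exponents + q ^ (ρ + (1 - (N : ℝ)) / 2) * hv'
  · have exponents : q ^ (-lam + (3 * (N : ℝ) + 1) / 2 - 2 * y) * q ^ (-2 * (N : ℝ) - 2)
        * q ^ (2 * lam) * q ^ (2 * (y + 1 : ℕ) : ℝ) = q ^ (lam + (1 - (N : ℝ)) / 2) := by
      simp only [← Real.rpow_add hq]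
      push_cast
      ring_nf
    linear_combination -v * exponents

lemma qPoch_mul_rvSite (hq : 0 < q) (hq1 : q ≠ 1) (hx : x ≤ N) (hy : y ≤ N) {lam ρ v : ℝ}
    (hv : v ≠ 0) (hα : qPoch (-v⁻¹ * q ^ (ρ + lam - N + 1)) (q ^ 2) (min x y) ≠ 0)
    (hβδ : qPoch (-v * q ^ (ρ + lam - N + 1)) (q ^ 2) (min x y) ≠ 0) :
    qPoch (v * q ^ (-2 * (x : ℝ) - ρ + lam + N + 1)) (q ^ 2) x * rvSite y x lam ρ v N q
      = v ^ y / q ^ ((y : ℝ) * ((y : ℝ) + ρ + lam - N))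
        * qPoch (-v⁻¹ * q ^ (ρ + lam - N + 1)) (q ^ 2) y
        * qPoch (-v * q ^ (ρ + lam - N + 1)) (q ^ 2) x
        * qPoch (v * q ^ (2 * (y : ℝ) - ρ + lam - N + 1)) (q ^ 2) (N - y)
        * qRacah x y (-v⁻¹ * q ^ (ρ + lam - N - 1)) (v * q ^ (ρ - lam - N - 1))
          (q ^ (-2 * (N : ℝ) - 2)) (-q ^ (2 * lam)) (q ^ 2) := by
  set b := q ^ (-ρ + (1 - (N : ℝ)) / 2) with hb
  set c := -v * q ^ (-lam + (3 * (N : ℝ) + 1) / 2 - 2 * y) with hc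
  set e := v * q ^ (lam + (1 - (N : ℝ)) / 2) with he
  obtain ⟨hγ_param, hα_param, ha_param, he_param⟩ := rSite_parameters hq y N lam ρ hv
  have αp : -v⁻¹ * q ^ (ρ + lam - N - 1) * q ^ 2 = -v⁻¹ * q ^ (ρ + lam - N + 1) := by
    rw [mul_assoc, ← Real.rpow_add_natCast hq.ne']
    ring_nf
  have βδp : v * q ^ (ρ - lam - N - 1) * -q ^ (2 * lam) * q ^ 2 = -v * q ^ (ρ + lam - N + 1) := by
    have exponents : q ^ (ρ - lam - N - 1) * q ^ (2 * lam) * q ^ 2 = q ^ (ρ + lam - N + 1) := by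
      rw [← Real.rpow_add hq, ← Real.rpow_add_natCast hq.ne']
      ring_nf
    linear_combination -v * exponents
  have eb_x : e * b * (q ^ 2) ^ (N - x) = v * q ^ (-2 * (x : ℝ) - ρ + lam + N + 1) := by
    rw [hb, he, sq_pow_eq_rpow, Nat.cast_sub hx, mul_assoc, mul_assoc, ← Real.rpow_add hq,
      ← Real.rpow_add hq]
    ring_nf
  have eb_y : e * (q ^ 2) ^ y * b = v * q ^ (2 * (y : ℝ) - ρ + lam - N + 1) := by
    rw [hb, he, sq_pow_eq_rpow, mul_assoc, mul_assoc, ← Real.rpow_add hq, ← Real.rpow_add hq]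
    ring_nf
  have prefactor : (-(c * b)) ^ y * (q ^ 2) ^ y.choose 2
      = v ^ y / q ^ ((y : ℝ) * ((y : ℝ) + ρ + lam - N)) := by
    have cb : -(c * b) = v * q ^ (-lam - ρ + N + 1 - 2 * y) := by
      rw [hc, hb, neg_mul, neg_mul, neg_neg, mul_assoc, ← Real.rpow_add hq]
      ring_nf
    rw [cb, sq_pow_choose_two, mul_pow, ← Real.rpow_mul_natCast hq.le, mul_assoc,
      ← Real.rpow_add hq, div_eq_mul_inv, ← Real.rpow_neg hq.le]
    ring_nf
  have racah := qPoch_mul_pairing_eq_qRacah (x := x) (y := y) (pow_pos hq 2)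
    (sq_ne_one_of_pos hq hq1) hx hy (a := -q ^ (ρ + (1 - (N : ℝ)) / 2)) (b := b) (c := c) (e := e)
    (α := -v⁻¹ * q ^ (ρ + lam - N - 1)) (β := v * q ^ (ρ - lam - N - 1)) (δ := -q ^ (2 * lam))
    (γ := q ^ (-2 * (N : ℝ) - 2)) (fun b => momentFunctional_qPochPoly hq hq1 hy lam v b)
    hγ_param hα_param ha_param he_param
    (αp ▸ hα) (βδp ▸ hβδ)
  rwa [← rvSite_eq_momentFunctional hq hq1 hx, αp, βδp, eb_x, eb_y, prefactor] at racah

theorem rvSite_eq_rSite (hq : 0 < q) (hq1 : q ≠ 1) (hx : x ≤ N) (hy : y ≤ N) {lam ρ v : ℝ}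
    (hv : v ≠ 0) (h : RegularSite y x lam ρ v N q) :
    rvSite y x lam ρ v N q = rSite y x lam ρ v N q := by
  obtain ⟨hden, hα, hβδ⟩ := h
  have closed := qPoch_mul_rvSite hq hq1 hx hy hv hα hβδ
  have shift_x : v * q ^ (-2 * (x : ℝ) - ρ + lam + N + 1) * (q ^ 2) ^ x
      = v * q ^ (-ρ + lam + N + 1) := by
    rw [sq_pow_eq_rpow, mul_assoc, ← Real.rpow_add hq]
    ring_nf
  have shift_y : v * q ^ (2 * (y : ℝ) - ρ + lam - N + 1) * (q ^ 2) ^ (N - y)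
      = v * q ^ (-ρ + lam + N + 1) := by
    rw [sq_pow_eq_rpow, Nat.cast_sub hy, mul_assoc, ← Real.rpow_add hq]
    ring_nf
  have split_N := qPoch_add (v * q ^ (2 * (y : ℝ) - ρ + lam - N + 1)) (q ^ 2) (N - y) y
  rw [Nat.sub_add_cancel hy, shift_y] at split_N
  rw [qPoch_add, shift_x] at hden
  rw [rSite, cr, split_N, qPoch_add _ _ x y, shift_x]
  refine mul_left_cancel₀ (left_ne_zero_of_mul hden) (closed.trans ?_)
  have hD₁ := left_ne_zero_of_mul hden
  have hD₂ := right_ne_zero_of_mul hden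
  generalize qPoch (v * q ^ (-2 * (x : ℝ) - ρ + lam + N + 1)) (q ^ 2) x = D₁ at hD₁ ⊢
  generalize qPoch (v * q ^ (-ρ + lam + N + 1)) (q ^ 2) y = D₂ at hD₂ ⊢
  field_simp

end OneSite

/-! ### The product formula for `R^v` -/

lemma eventually_qPoch_ne_zero {f : ℝ → ℝ} (hf : f.Injective) (v c p : ℝ) (n : ℕ) :
    ∀ᶠ w in 𝓝[≠] v, qPoch (f w * c) p n ≠ 0 := by
  have avoid : ∀ᶠ w in 𝓝[≠] v, ∀ j ∈ Finset.range n, f w ≠ (c * p ^ j)⁻¹ :=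
    (Finset.eventually_all _).2 fun j _ =>
      nhdsNE_le_cofinite v (hf.tendsto_cofinite.eventually (eventually_cofinite_ne _))
  filter_upwards [avoid] with w hw
  refine Finset.prod_ne_zero_iff.2 fun j hj h => hw j hj (eq_inv_of_mul_eq_one_left ?_)
  rw [← mul_assoc, ← sub_eq_zero.1 h]

lemma eventually_regularSite (y x : ℕ) (lam ρ v : ℝ) (N : ℕ) (q : ℝ) :
    ∀ᶠ w in 𝓝[≠] v, RegularSite y x lam ρ w N q := by
  have denom := eventually_qPoch_ne_zero Function.injective_id v
    (q ^ (-2 * (x : ℝ) - ρ + lam + N + 1)) (q ^ 2) (x + y)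
  have lower_α := eventually_qPoch_ne_zero inv_injective v (-q ^ (ρ + lam - N + 1)) (q ^ 2)
    (min x y)
  have lower_βδ := eventually_qPoch_ne_zero Function.injective_id v (-q ^ (ρ + lam - N + 1)) (q ^ 2)
    (min x y)
  filter_upwards [denom, lower_α, lower_βδ] with w hdenom hα hβδ
  exact ⟨hdenom, by rwa [neg_mul_comm], by rwa [neg_mul_comm]⟩

lemma eventually_regular {m : ℕ} {N : Fin (m + 1) → ℕ} (q lam ρ v : ℝ) (ζ ξ : Config N) :
    ∀ᶠ w in 𝓝[≠] v, Regular q lam ρ w ζ ξ :=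
  eventually_all.2 fun _ => eventually_regularSite _ _ _ _ _ _ _

lemma Rv_eq_prod_rvSite {m : ℕ} {N : Fin (m + 1) → ℕ} {q : ℝ} (hq : 0 < q) (lam ρ v : ℝ)
    (ζ ξ : Config N) :
    Rv q lam ρ v ζ ξ = ∏ i, rvSite (ζ i) (ξ i) (hMinus lam ζ (i : ℕ)) (hPlus ρ ξ ((i : ℕ) + 2)) v
      (N i) q := by
  simp only [rvSite, Finset.sum_range, Finset.prod_univ_sum, Fintype.piFinset_univ]
  refine Finset.sum_congr rfl fun η _ => ?_
  have powers_cancel : q ^ (-(1 / 2) * uExp η) * q ^ (-(1 / 2) * uExp η) * q ^ uExp η = 1 := by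
    rw [← Real.rpow_add hq, ← Real.rpow_add hq]
    ring_nf
    exact Real.rpow_zero q
  rw [KL, KR, wConfig, total, ← Finset.prod_pow_eq_pow_sum]
  simp only [Finset.prod_mul_distrib]
  linear_combination (∏ i, kSite (η i) (ζ i) (hMinus lam ζ (i : ℕ)) (N i) q⁻¹)
    * (∏ i, kSite (η i) (ξ i) (hPlus ρ ξ ((i : ℕ) + 2)) (N i) q)
    * (∏ i, wSite (η i) (N i) q) * (∏ i, (-v) ^ (η i : ℕ)) * powers_cancel

theorem Rv_eq_racahProduct {m : ℕ} {N : Fin (m + 1) → ℕ} {q : ℝ} (hq : 0 < q) (hq1 : q ≠ 1)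
    {lam ρ v : ℝ} (hv : v ≠ 0) {ζ ξ : Config N} (h : Regular q lam ρ v ζ ξ) :
    Rv q lam ρ v ζ ξ = racahProduct q lam ρ v ζ ξ := by
  rw [Rv_eq_prod_rvSite hq]
  exact Finset.prod_congr rfl fun i _ => rvSite_eq_rSite hq hq1 (Nat.le_of_lt_succ (ξ i).isLt)
    (Nat.le_of_lt_succ (ζ i).isLt) hv (h i)

theorem tendsto_racahProduct {m : ℕ} {N : Fin (m + 1) → ℕ} {q : ℝ} (hq : 0 < q) (hq1 : q ≠ 1)
    (lam ρ v : ℝ) (ζ ξ : Config N) :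
    Tendsto (fun w => racahProduct q lam ρ w ζ ξ) (𝓝[≠] v) (𝓝 (Rv q lam ρ v ζ ξ)) := by
  have continuous_Rv : Continuous fun w => Rv q lam ρ w ζ ξ := by
    unfold Rv
    fun_prop
  refine Tendsto.congr' ?_ (continuous_Rv.continuousAt.tendsto.mono_left nhdsWithin_le_nhds)
  filter_upwards [eventually_regular q lam ρ v ζ ξ,
    nhdsNE_le_cofinite v (eventually_cofinite_ne 0)] with w hw hw0
  exact Rv_eq_racahProduct hq hq1 hw0 hw

/-! ### The asymmetric exclusion process on two neighbouring sites -/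

/-- ASEP rate for a jump from the left to the right one of two neighbouring sites with capacities
`N₁`, `N₂` and occupation numbers `a`, `b`. -/
def rateRight (q : ℝ) (N₁ N₂ a b : ℕ) : ℝ :=
  q ^ (-((b : ℝ) + N₁ - a + 1)) * qNum q a * qNum q ((N₂ : ℝ) - b)

/-- ASEP rate for a jump from the right to the left one of two neighbouring sites. -/
def rateLeft (q : ℝ) (N₁ N₂ a b : ℕ) : ℝ :=
  q ^ ((a : ℝ) + N₂ - b + 1) * qNum q b * qNum q ((N₁ : ℝ) - a)

lemma rateRight_zero_left (q : ℝ) (N₁ N₂ b : ℕ) : rateRight q N₁ N₂ 0 b = 0 := by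
  simp [rateRight, qNum]

lemma rateRight_full_right (q : ℝ) (N₁ N₂ a : ℕ) : rateRight q N₁ N₂ a N₂ = 0 := by
  simp [rateRight, qNum]

lemma rateLeft_zero_right (q : ℝ) (N₁ N₂ a : ℕ) : rateLeft q N₁ N₂ a 0 = 0 := by
  simp [rateLeft, qNum]

lemma rateLeft_full_left (q : ℝ) (N₁ N₂ b : ℕ) : rateLeft q N₁ N₂ N₁ b = 0 := by
  simp [rateLeft, qNum]

lemma sub_inv_ne_zero_of_pos {q : ℝ} (hq : 0 < q) (hq1 : q ≠ 1) : q - q⁻¹ ≠ 0 := fun h =>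
  sq_ne_one_of_pos hq hq1 (by field_simp at h; linarith)

lemma qNum_eq_one_sub {q : ℝ} (hq : 0 < q) (hq1 : q ≠ 1) (a : ℝ) :
    qNum q a = -(q ^ (-a) * (1 - q ^ (2 * a)) / (q - q⁻¹)) := by
  rw [qNum, if_neg hq1, mul_sub, ← Real.rpow_add hq]
  ring_nf

lemma wSite_succ_mul_qNum {q : ℝ} (hq : 0 < q) (hq1 : q ≠ 1) {n N : ℕ} (h : n < N) :
    wSite (n + 1) N q * qNum q (n + 1 : ℕ) = wSite n N q * qNum q ((N : ℝ) - n) := by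
  have binom := gaussBinom_succ_right_mul (q ^ 2) h.le
  have exponents : q ^ (((n + 1 : ℕ) : ℝ) * (((n + 1 : ℕ) : ℝ) - N)) * q ^ (-((n + 1 : ℕ) : ℝ))
      = q ^ ((n : ℝ) * (n - N)) * q ^ (-((N : ℝ) - n)) := by
    rw [← Real.rpow_add hq, ← Real.rpow_add hq]
    push_cast
    ring_nf
  rw [sq_pow_eq_rpow, sq_pow_eq_rpow, Nat.cast_sub h.le] at binom
  rw [wSite, wSite, qBinom_eq_gaussBinom (by positivity) (sq_ne_one_of_pos hq hq1) h,
    qBinom_eq_gaussBinom (by positivity) (sq_ne_one_of_pos hq hq1) h.le, qNum_eq_one_sub hq hq1,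
    qNum_eq_one_sub hq hq1]
  linear_combination (-(gaussBinom (q ^ 2) N (n + 1)
    * (1 - q ^ (2 * ((n + 1 : ℕ) : ℝ))) / (q - q⁻¹))) * exponents
    - q ^ ((n : ℝ) * (n - N)) * q ^ (-((N : ℝ) - n)) / (q - q⁻¹) * binom

lemma wSite_mul_rateRight {q : ℝ} (hq : 0 < q) (hq1 : q ≠ 1) {N₁ N₂ a b : ℕ} (ha : a < N₁)
    (hb : b < N₂) :
    q ^ N₁ * q ^ N₂ * (wSite (a + 1) N₁ q * wSite b N₂ q * rateRight q N₁ N₂ (a + 1) b)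
      = wSite a N₁ q * wSite (b + 1) N₂ q * rateLeft q N₁ N₂ a (b + 1) := by
  have exponents : q ^ N₁ * q ^ N₂ * q ^ (-((b : ℝ) + N₁ - (a + 1 : ℕ) + 1))
      = q ^ ((a : ℝ) + N₂ - (b + 1 : ℕ) + 1) := by
    rw [← Real.rpow_natCast, ← Real.rpow_natCast, ← Real.rpow_add hq, ← Real.rpow_add hq]
    push_cast
    ring_nf
  rw [rateRight, rateLeft, ← exponents]
  linear_combination q ^ N₁ * q ^ N₂ * q ^ (-((b : ℝ) + N₁ - (a + 1 : ℕ) + 1))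
    * (wSite b N₂ q * qNum q ((N₂ : ℝ) - b) * wSite_succ_mul_qNum hq hq1 ha
      - wSite a N₁ q * qNum q ((N₁ : ℝ) - a) * wSite_succ_mul_qNum hq hq1 hb)

lemma rateRight_eq {q : ℝ} (hq : 0 < q) (hq1 : q ≠ 1) (N₁ N₂ a b : ℕ) :
    rateRight q N₁ N₂ a b = (q * q ^ N₁)⁻¹ * ((q ^ 2) ^ a - 1)
      * (q ^ N₂ / (q ^ 2) ^ b - (q ^ N₂)⁻¹) / (q - q⁻¹) ^ 2 := by
  have := sub_inv_ne_zero_of_pos hq hq1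
  simp only [rateRight, qNum, if_neg hq1, Real.rpow_neg hq.le, Real.rpow_sub hq, Real.rpow_add hq,
    Real.rpow_one, Real.rpow_natCast, pow_right_comm q 2]
  field_simp

lemma rateLeft_eq {q : ℝ} (hq : 0 < q) (hq1 : q ≠ 1) (N₁ N₂ a b : ℕ) :
    rateLeft q N₁ N₂ a b = q * q ^ N₂ * (1 - ((q ^ 2) ^ b)⁻¹)
      * (q ^ N₁ - (q ^ N₁)⁻¹ * (q ^ 2) ^ a) / (q - q⁻¹) ^ 2 := by
  have := sub_inv_ne_zero_of_pos hq hq1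
  simp only [rateLeft, qNum, if_neg hq1, Real.rpow_neg hq.le, Real.rpow_sub hq, Real.rpow_add hq,
    Real.rpow_one, Real.rpow_natCast, pow_right_comm q 2]
  field_simp

/-- The weighted generating function of a sequence on one site. -/
def siteGF (q : ℝ) (N : ℕ) (f : ℕ → ℝ) (t : ℝ) : ℝ :=
  ∑ n ∈ Finset.range (N + 1), wSite n N q * f n * t ^ n

/-- The weighted generating function of a function of the occupation numbers of two sites. -/
def pairGF (q : ℝ) (N₁ N₂ : ℕ) (φ : ℕ → ℕ → ℝ) (s t : ℝ) : ℝ :=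
  ∑ a ∈ Finset.range (N₁ + 1), ∑ b ∈ Finset.range (N₂ + 1),
    wSite a N₁ q * wSite b N₂ q * φ a b * (s ^ a * t ^ b)

lemma pairGF_mul (q : ℝ) (N₁ N₂ : ℕ) (f g : ℕ → ℝ) (s t : ℝ) :
    pairGF q N₁ N₂ (fun a b => f a * g b) s t = siteGF q N₁ f s * siteGF q N₂ g t := by
  rw [pairGF, siteGF, siteGF, Finset.sum_mul_sum]
  exact Finset.sum_congr rfl fun a _ => Finset.sum_congr rfl fun b _ => by ring

lemma pairGF_add (q : ℝ) (N₁ N₂ : ℕ) (φ ψ : ℕ → ℕ → ℝ) (s t : ℝ) :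
    pairGF q N₁ N₂ (fun a b => φ a b + ψ a b) s t
      = pairGF q N₁ N₂ φ s t + pairGF q N₁ N₂ ψ s t := by
  simp only [pairGF, mul_add, add_mul, Finset.sum_add_distrib]

lemma pairGF_sub (q : ℝ) (N₁ N₂ : ℕ) (φ ψ : ℕ → ℕ → ℝ) (s t : ℝ) :
    pairGF q N₁ N₂ (fun a b => φ a b - ψ a b) s t
      = pairGF q N₁ N₂ φ s t - pairGF q N₁ N₂ ψ s t := by
  simp only [pairGF, mul_sub, sub_mul, Finset.sum_sub_distrib]

lemma pairGF_const_mul (q : ℝ) (N₁ N₂ : ℕ) (c : ℝ) (φ : ℕ → ℕ → ℝ) (s t : ℝ) :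
    pairGF q N₁ N₂ (fun a b => c * φ a b) s t = c * pairGF q N₁ N₂ φ s t := by
  simp only [pairGF, Finset.mul_sum]
  exact Finset.sum_congr rfl fun a _ => Finset.sum_congr rfl fun b _ => by ring

lemma eq_zero_of_eventually_sum_pow_eq_zero {N : ℕ} {d : ℕ → ℝ}
    (h : ∀ᶠ t in cofinite, ∑ n ∈ Finset.range (N + 1), d n * t ^ n = 0) {n : ℕ} (hn : n ≤ N) :
    d n = 0 := by
  set P : Polynomial ℝ := ∑ n ∈ Finset.range (N + 1), Polynomial.monomial n (d n) with hP
  have hP0 : P = 0 := by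
    refine Polynomial.eq_zero_of_infinite_isRoot P (frequently_cofinite_iff_infinite.1 ?_)
    refine (h.mono fun t ht => ?_).frequently
    simpa [hP, Polynomial.eval_finsetSum] using ht
  have hcoeff : P.coeff n = d n := by
    simp [hP, Polynomial.finsetSum_coeff, Polynomial.coeff_monomial, hn]
  rw [← hcoeff, hP0, Polynomial.coeff_zero]

lemma eq_of_eventually_pairGF_eq {q : ℝ} (hq : 0 < q) (hq1 : q ≠ 1) {N₁ N₂ : ℕ}
    {φ ψ : ℕ → ℕ → ℝ}
    (h : ∀ᶠ s in cofinite, ∀ᶠ t in cofinite, pairGF q N₁ N₂ φ s t = pairGF q N₁ N₂ ψ s t)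
    {a b : ℕ} (ha : a ≤ N₁) (hb : b ≤ N₂) : φ a b = ψ a b := by
  have hw : wSite a N₁ q * wSite b N₂ q ≠ 0 :=
    mul_ne_zero (wSite_pos hq hq1 ha).ne' (wSite_pos hq hq1 hb).ne'
  refine sub_eq_zero.1 ((mul_eq_zero.1 ?_).resolve_left hw)
  refine eq_zero_of_eventually_sum_pow_eq_zero (N := N₁)
    (d := fun a => wSite a N₁ q * wSite b N₂ q * (φ a b - ψ a b)) (h.mono fun s hs => ?_) ha
  refine eq_zero_of_eventually_sum_pow_eq_zero (N := N₂)
    (d := fun b => ∑ a ∈ Finset.range (N₁ + 1),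
      wSite a N₁ q * wSite b N₂ q * (φ a b - ψ a b) * s ^ a) (hs.mono fun t ht => ?_) hb
  rw [← sub_eq_zero, ← pairGF_sub, pairGF, Finset.sum_comm] at ht
  rw [← ht]
  refine Finset.sum_congr rfl fun b _ => ?_
  rw [Finset.sum_mul]
  exact Finset.sum_congr rfl fun a _ => by ring

lemma sum_range_succ_shift_left (N₁ N₂ : ℕ) (φ : ℕ → ℕ → ℝ) (h0 : ∀ b, φ 0 b = 0)
    (h1 : ∀ a, φ a N₂ = 0) :
    ∑ a ∈ Finset.range (N₁ + 1), ∑ b ∈ Finset.range (N₂ + 1), φ a b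
      = ∑ a ∈ Finset.range N₁, ∑ b ∈ Finset.range N₂, φ (a + 1) b := by
  simp [Finset.sum_range_succ' _ N₁, Finset.sum_range_succ _ N₂, h0, h1]

lemma sum_range_succ_shift_right (N₁ N₂ : ℕ) (φ : ℕ → ℕ → ℝ) (h0 : ∀ a, φ a 0 = 0)
    (h1 : ∀ b, φ N₁ b = 0) :
    ∑ a ∈ Finset.range (N₁ + 1), ∑ b ∈ Finset.range (N₂ + 1), φ a b
      = ∑ a ∈ Finset.range N₁, ∑ b ∈ Finset.range N₂, φ a (b + 1) := by
  simp [Finset.sum_range_succ _ N₁, Finset.sum_range_succ' _ N₂, h0, h1]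

lemma pairGF_rateRight_shift {q : ℝ} (hq : 0 < q) (hq1 : q ≠ 1) (N₁ N₂ : ℕ) (φ : ℕ → ℕ → ℝ)
    (s : ℝ) {t : ℝ} (ht : t ≠ 0) :
    pairGF q N₁ N₂ (fun a b => rateRight q N₁ N₂ a b * φ (a - 1) (b + 1)) s t
      = (q ^ N₁ * q ^ N₂)⁻¹ * (s / t)
        * pairGF q N₁ N₂ (fun a b => rateLeft q N₁ N₂ a b * φ a b) s t := by
  rw [pairGF, pairGF, sum_range_succ_shift_left, sum_range_succ_shift_right, Finset.mul_sum]
  · refine Finset.sum_congr rfl fun a ha => ?_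
    rw [Finset.mul_sum]
    refine Finset.sum_congr rfl fun b hb => ?_
    have balance := wSite_mul_rateRight hq hq1 (Finset.mem_range.1 ha) (Finset.mem_range.1 hb)
    have hN : q ^ N₁ * q ^ N₂ ≠ 0 := by positivity
    rw [Nat.add_sub_cancel, ← div_eq_inv_mul, div_mul_eq_mul_div, eq_div_iff hN]
    have moment : s / t * (s ^ a * t ^ (b + 1)) = s ^ (a + 1) * t ^ b := by
      rw [pow_succ, pow_succ]
      field_simp
    linear_combination φ a (b + 1) * (s ^ (a + 1) * t ^ b) * balance
      - wSite a N₁ q * wSite (b + 1) N₂ q * (rateLeft q N₁ N₂ a (b + 1) * φ a (b + 1)) * moment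
  · simp [rateLeft_zero_right]
  · simp [rateLeft_full_left]
  · simp [rateRight_zero_left]
  · simp [rateRight_full_right]

lemma pairGF_rateLeft_shift {q : ℝ} (hq : 0 < q) (hq1 : q ≠ 1) (N₁ N₂ : ℕ) (φ : ℕ → ℕ → ℝ)
    {s t : ℝ} (hs : s ≠ 0) (ht : t ≠ 0) :
    pairGF q N₁ N₂ (fun a b => rateLeft q N₁ N₂ a b * φ (a + 1) (b - 1)) s t
      = q ^ N₁ * q ^ N₂ * (t / s)
        * pairGF q N₁ N₂ (fun a b => rateRight q N₁ N₂ a b * φ a b) s t := by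
  have shift := pairGF_rateRight_shift hq hq1 N₁ N₂ (fun a b => φ (a + 1) (b - 1)) s ht
  have unshift : ∀ a b, rateRight q N₁ N₂ a b * φ (a - 1 + 1) (b + 1 - 1)
      = rateRight q N₁ N₂ a b * φ a b := by
    rintro (_ | a) b
    · simp [rateRight_zero_left]
    · rfl
  simp only [unshift] at shift
  rw [shift]
  field_simp

lemma pairGF_rateRight {q : ℝ} (hq : 0 < q) (hq1 : q ≠ 1) (N₁ N₂ : ℕ) (f g : ℕ → ℝ) (s t : ℝ) :
    pairGF q N₁ N₂ (fun a b => rateRight q N₁ N₂ a b * (f a * g b)) s t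
      = (q * q ^ N₁)⁻¹ * (siteGF q N₁ f (q ^ 2 * s) - siteGF q N₁ f s)
        * (q ^ N₂ * siteGF q N₂ g (t / q ^ 2) - (q ^ N₂)⁻¹ * siteGF q N₂ g t) / (q - q⁻¹) ^ 2 := by
  rw [mul_assoc]
  simp only [pairGF, siteGF]
  rw [Finset.mul_sum, Finset.mul_sum, ← Finset.sum_sub_distrib, ← Finset.sum_sub_distrib,
    Finset.sum_mul_sum]
  simp only [Finset.mul_sum, Finset.sum_div]
  refine Finset.sum_congr rfl fun a _ => Finset.sum_congr rfl fun b _ => ?_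
  rw [rateRight_eq hq hq1, mul_pow, div_pow]
  ring

lemma pairGF_rateLeft {q : ℝ} (hq : 0 < q) (hq1 : q ≠ 1) (N₁ N₂ : ℕ) (f g : ℕ → ℝ) (s t : ℝ) :
    pairGF q N₁ N₂ (fun a b => rateLeft q N₁ N₂ a b * (f a * g b)) s t
      = q * q ^ N₂ * (q ^ N₁ * siteGF q N₁ f s - (q ^ N₁)⁻¹ * siteGF q N₁ f (q ^ 2 * s))
        * (siteGF q N₂ g t - siteGF q N₂ g (t / q ^ 2)) / (q - q⁻¹) ^ 2 := by
  rw [mul_assoc]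
  simp only [pairGF, siteGF]
  rw [Finset.mul_sum, Finset.mul_sum, ← Finset.sum_sub_distrib, ← Finset.sum_sub_distrib,
    Finset.sum_mul_sum]
  simp only [Finset.mul_sum, Finset.sum_div]
  refine Finset.sum_congr rfl fun a _ => Finset.sum_congr rfl fun b _ => ?_
  rw [rateLeft_eq hq hq1, mul_pow, div_pow]
  ring

/-- The generator of ASEP on two sites acting on `D ^ b * f a * g b`, divided by `D ^ b`; the
constant `D` accounts for the factor `q ^ (-u(η) / 2)` of the duality functions on `M` sites. -/
def bondOp (q : ℝ) (N₁ N₂ : ℕ) (D : ℝ) (f g : ℕ → ℝ) (a b : ℕ) : ℝ :=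
  rateRight q N₁ N₂ a b * (D * (f (a - 1) * g (b + 1)) - f a * g b)
    + rateLeft q N₁ N₂ a b * (D⁻¹ * (f (a + 1) * g (b - 1)) - f a * g b)

lemma pairGF_bondOp {q : ℝ} (hq : 0 < q) (hq1 : q ≠ 1) (N₁ N₂ : ℕ) {D : ℝ}
    (hD : D ^ 2 = q ^ N₁ * q ^ N₂) (f g : ℕ → ℝ) {s t : ℝ} (hs : s ≠ 0) (ht : t ≠ 0) :
    pairGF q N₁ N₂ (bondOp q N₁ N₂ D f g) s t
      = (s / (D * t) - 1) * pairGF q N₁ N₂ (fun a b => rateLeft q N₁ N₂ a b * (f a * g b)) s t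
        + (D * t / s - 1)
          * pairGF q N₁ N₂ (fun a b => rateRight q N₁ N₂ a b * (f a * g b)) s t := by
  have hD0 : D ≠ 0 := by
    rintro rfl
    exact (mul_pos (pow_pos hq N₁) (pow_pos hq N₂)).ne (by simpa using hD)
  have shiftRight := pairGF_rateRight_shift hq hq1 N₁ N₂ (fun a b => f a * g b) s ht
  have shiftLeft := pairGF_rateLeft_shift hq hq1 N₁ N₂ (fun a b => f a * g b) hs ht
  have split : bondOp q N₁ N₂ D f g = fun a b =>
      D * (rateRight q N₁ N₂ a b * (f (a - 1) * g (b + 1)))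
        - rateRight q N₁ N₂ a b * (f a * g b)
      + (D⁻¹ * (rateLeft q N₁ N₂ a b * (f (a + 1) * g (b - 1)))
        - rateLeft q N₁ N₂ a b * (f a * g b)) := by
    funext a b
    rw [bondOp]
    ring
  rw [split, pairGF_add, pairGF_sub, pairGF_sub, pairGF_const_mul, pairGF_const_mul, shiftRight,
    shiftLeft, ← hD]
  field_simp
  ring

/-- The generating function of the one-site functions `k` in a rescaled variable `s`, with base `Q`
and `R = q ^ ρ`. -/
def sitePoly (Q R s : ℝ) (x y : ℕ) : ℝ := qPoch (-(R * s)) Q x * qPoch (s / R) Q y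

lemma siteGF_kSite {q : ℝ} (hq : 0 < q) (hq1 : q ≠ 1) {x N : ℕ} (hx : x ≤ N) (ρ t : ℝ) :
    siteGF q N (fun n => kSite n x ρ N q) t
      = sitePoly (q ^ 2) (q ^ ρ) (q ^ ((1 - (N : ℝ)) / 2) * t) x (N - x) := by
  rw [siteGF, sum_wSite_mul_kSite hq hq1 hx, sitePoly, Real.rpow_add hq, Real.rpow_add hq,
    Real.rpow_neg hq.le]
  congr 2 <;> ring

lemma sitePoly_mul_base (Q R s : ℝ) (x y : ℕ) :
    (1 + R * s) * (1 - s / R) * sitePoly Q R (Q * s) x y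
      = sitePoly Q R s x y * ((1 + R * s * Q ^ x) * (1 - s / R * Q ^ y)) := by
  have h1 := qPoch_mul_base (-(R * s)) Q x
  have h2 := qPoch_mul_base (s / R) Q y
  rw [sitePoly, sitePoly, show -(R * (Q * s)) = -(R * s) * Q by ring,
    show Q * s / R = s / R * Q by ring]
  linear_combination (1 - s / R) * qPoch (s / R * Q) Q y * h1
    + qPoch (-(R * s)) Q x * (1 + R * s * Q ^ x) * h2

lemma sitePoly_div_base {Q : ℝ} (hQ : Q ≠ 0) (R s : ℝ) (x y : ℕ) :
    (1 + R * s * Q ^ x / Q) * (1 - s / R * Q ^ y / Q) * sitePoly Q R (s / Q) x y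
      = sitePoly Q R s x y * ((1 + R * s / Q) * (1 - s / R / Q)) := by
  have h := sitePoly_mul_base Q R (s / Q) x y
  rw [mul_div_cancel₀ _ hQ] at h
  linear_combination -h

lemma sitePoly_raise {Q : ℝ} (hQ : Q ≠ 0) (R s : ℝ) (x y : ℕ) :
    (1 + R * s) * sitePoly Q (R * Q) s x (y + 1)
      = sitePoly Q R s (x + 1) y * (1 - s / R / Q) := by
  rw [sitePoly, sitePoly, qPoch_succ_left, qPoch_succ_left,
    show s / (R * Q) * Q = s / R by field_simp, show -(R * Q * s) = -(R * s) * Q by ring,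
    div_div]
  ring

lemma sitePoly_lower {Q : ℝ} (hQ : Q ≠ 0) (R s : ℝ) (x y : ℕ) :
    (1 - s / R) * sitePoly Q (R / Q) s (x + 1) y
      = sitePoly Q R s x (y + 1) * (1 + R * s / Q) := by
  rw [sitePoly, sitePoly, qPoch_succ_left, qPoch_succ_left,
    show s / (R / Q) = s / R * Q by rw [div_div_eq_mul_div]; ring,
    show -(R / Q * s) * Q = -(R * s) by field_simp]
  ring

lemma sitePoly_move (Q R s : ℝ) (x y : ℕ) :
    (1 - s / R * Q ^ y) * sitePoly Q R s (x + 1) y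
      = sitePoly Q R s x (y + 1) * (1 + R * s * Q ^ x) := by
  rw [sitePoly, sitePoly, qPoch_succ, qPoch_succ]
  ring

/-- Jump rate to the right for two neighbouring sites of the dynamic process with right boundary
value, where `h` is the height `h⁺` between the two sites. -/
def dynRight (q h : ℝ) (N₁ N₂ x₁ x₂ : ℕ) : ℝ :=
  rateRight q N₁ N₂ x₁ x₂ *
    (((1 + q ^ (2 * (x₁ : ℝ) - 2 * (h + (2 * x₁ - N₁)))) * (1 + q ^ (2 * (x₂ : ℝ) - 2 * h)))
      / ((1 + q ^ (-2 * h)) * (1 + q ^ (-2 * h - 2))))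

/-- Jump rate to the left for two neighbouring sites of the dynamic process with right boundary
value, where `h` is the height `h⁺` between the two sites. -/
def dynLeft (q h : ℝ) (N₁ N₂ x₁ x₂ : ℕ) : ℝ :=
  rateLeft q N₁ N₂ x₁ x₂ *
    (((1 + q ^ (-2 * (x₁ : ℝ) - 2 * h)) * (1 + q ^ (-2 * (x₂ : ℝ) - 2 * (h - (2 * x₂ - N₂)))))
      / ((1 + q ^ (-2 * h)) * (1 + q ^ (-2 * h + 2))))

lemma dynRight_zero_left (q h : ℝ) (N₁ N₂ b : ℕ) : dynRight q h N₁ N₂ 0 b = 0 := by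
  rw [dynRight, rateRight_zero_left, zero_mul]

lemma dynRight_full_right (q h : ℝ) (N₁ N₂ a : ℕ) : dynRight q h N₁ N₂ a N₂ = 0 := by
  rw [dynRight, rateRight_full_right, zero_mul]

lemma dynLeft_zero_right (q h : ℝ) (N₁ N₂ a : ℕ) : dynLeft q h N₁ N₂ a 0 = 0 := by
  rw [dynLeft, rateLeft_zero_right, zero_mul]

lemma dynLeft_full_left (q h : ℝ) (N₁ N₂ b : ℕ) : dynLeft q h N₁ N₂ N₁ b = 0 := by
  rw [dynLeft, rateLeft_full_left, zero_mul]

lemma rpow_two_mul {q : ℝ} (hq : 0 < q) (h : ℝ) : q ^ (2 * h) = (q ^ h) ^ 2 := by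
  rw [mul_comm, Real.rpow_mul hq.le, Real.rpow_two]

lemma dynRight_eq {q : ℝ} (hq : 0 < q) (hq1 : q ≠ 1) (h : ℝ) (N₁ N₂ x₁ x₂ : ℕ) :
    dynRight q h N₁ N₂ x₁ x₂ = (q * q ^ N₁)⁻¹ * ((q ^ 2) ^ x₁ - 1)
      * (q ^ N₂ / (q ^ 2) ^ x₂ - (q ^ N₂)⁻¹)
      * ((1 + (q ^ N₁) ^ 2 / ((q ^ h) ^ 2 * (q ^ 2) ^ x₁)) * (1 + (q ^ 2) ^ x₂ / (q ^ h) ^ 2)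
        / ((1 + ((q ^ h) ^ 2)⁻¹) * (1 + ((q ^ h) ^ 2)⁻¹ / q ^ 2))) / (q - q⁻¹) ^ 2 := by
  rw [dynRight, rateRight_eq hq hq1,
    show 2 * (x₁ : ℝ) - 2 * (h + (2 * x₁ - N₁)) = 2 * N₁ - (2 * h + 2 * x₁) by ring]
  simp only [neg_mul, Real.rpow_sub hq, Real.rpow_add hq, Real.rpow_neg hq.le, rpow_two_mul hq,
    Real.rpow_natCast, Real.rpow_two, pow_right_comm q 2]
  ring

lemma dynLeft_eq {q : ℝ} (hq : 0 < q) (hq1 : q ≠ 1) (h : ℝ) (N₁ N₂ x₁ x₂ : ℕ) :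
    dynLeft q h N₁ N₂ x₁ x₂ = q * q ^ N₂ * (1 - ((q ^ 2) ^ x₂)⁻¹)
      * (q ^ N₁ - (q ^ N₁)⁻¹ * (q ^ 2) ^ x₁)
      * ((1 + ((q ^ 2) ^ x₁ * (q ^ h) ^ 2)⁻¹) * (1 + (q ^ 2) ^ x₂ / ((q ^ h) ^ 2 * (q ^ N₂) ^ 2))
        / ((1 + ((q ^ h) ^ 2)⁻¹) * (1 + ((q ^ h) ^ 2)⁻¹ * q ^ 2))) / (q - q⁻¹) ^ 2 := by
  rw [dynLeft, rateLeft_eq hq hq1, show -2 * (x₁ : ℝ) - 2 * h = -(2 * x₁ + 2 * h) by ring,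
    show -2 * (x₂ : ℝ) - 2 * (h - (2 * x₂ - N₂)) = 2 * x₂ - (2 * h + 2 * N₂) by ring]
  simp only [neg_mul, Real.rpow_sub hq, Real.rpow_add hq, Real.rpow_neg hq.le, rpow_two_mul hq,
    Real.rpow_natCast, Real.rpow_two, pow_right_comm q 2]
  ring

lemma dynRight_mul_sitePoly {q : ℝ} (hq : 0 < q) {N₁ N₂ x₁ x₂ : ℕ} (hx₁ : x₁ ≤ N₁)
    (hx₂ : x₂ ≤ N₂) {ρ h : ℝ} (hρ : q ^ ρ * (q ^ 2) ^ x₂ = q ^ h * q ^ N₂) (s t : ℝ) :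
    (1 + q ^ h * s) * (1 - q ^ N₂ * t / q ^ h / q ^ 2) * (dynRight q h N₁ N₂ x₁ x₂
        * (sitePoly (q ^ 2) (q ^ (h + 2)) s (x₁ - 1) (N₁ - (x₁ - 1))
            * sitePoly (q ^ 2) (q ^ ρ) t (x₂ + 1) (N₂ - (x₂ + 1))))
      = dynRight q h N₁ N₂ x₁ x₂ * (sitePoly (q ^ 2) (q ^ h) s x₁ (N₁ - x₁)
          * sitePoly (q ^ 2) (q ^ ρ) t x₂ (N₂ - x₂))
        * ((1 - s / q ^ h / q ^ 2) * (1 + q ^ h * (q ^ N₂ * t))) := by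
  rcases x₁ with _ | x
  · rw [dynRight_zero_left]; ring
  obtain rfl | hlt := hx₂.eq_or_lt
  · rw [dynRight_full_right]; ring
  obtain ⟨y, rfl⟩ := Nat.exists_eq_add_of_lt hlt
  have raise := sitePoly_raise (pow_ne_zero 2 hq.ne') (q ^ h) s x (N₁ - (x + 1))
  have move := sitePoly_move (q ^ 2) (q ^ ρ) t x₂ y
  have upper : q ^ ρ * t * (q ^ 2) ^ x₂ = q ^ h * (q ^ (x₂ + y + 1) * t) := by
    linear_combination t * hρ
  have lower : t / q ^ ρ * (q ^ 2) ^ y = q ^ (x₂ + y + 1) * t / q ^ h / q ^ 2 := by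
    have := Real.rpow_pos_of_pos hq h
    have hr := Real.rpow_pos_of_pos hq ρ
    rw [div_mul_eq_mul_div, div_div, div_eq_div_iff hr.ne' (by positivity)]
    refine mul_right_cancel₀ (pow_ne_zero x₂ (pow_ne_zero 2 hq.ne')) ?_
    linear_combination (-(q ^ (x₂ + y + 1) * t)) * hρ
  rw [upper, lower] at move
  rw [Nat.add_sub_cancel, show N₁ - x = N₁ - (x + 1) + 1 by omega,
    show x₂ + y + 1 - x₂ = y + 1 by omega, show x₂ + y + 1 - (x₂ + 1) = y by omega,
    Real.rpow_add hq, Real.rpow_two]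
  linear_combination dynRight q h N₁ (x₂ + y + 1) (x + 1) x₂ *
    ((1 - q ^ (x₂ + y + 1) * t / q ^ h / q ^ 2) * sitePoly (q ^ 2) (q ^ ρ) t (x₂ + 1) y * raise
      + sitePoly (q ^ 2) (q ^ h) s (x + 1) (N₁ - (x + 1)) * (1 - s / q ^ h / q ^ 2) * move)

lemma dynLeft_mul_sitePoly {q : ℝ} (hq : 0 < q) {N₁ N₂ x₁ x₂ : ℕ} (hx₁ : x₁ ≤ N₁)
    (hx₂ : x₂ ≤ N₂) {ρ h : ℝ} (hρ : q ^ ρ * (q ^ 2) ^ x₂ = q ^ h * q ^ N₂) (s t : ℝ) :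
    (1 - s / q ^ h) * (1 + q ^ h * (q ^ N₂ * t) / q ^ 2) * (dynLeft q h N₁ N₂ x₁ x₂
        * (sitePoly (q ^ 2) (q ^ (h - 2)) s (x₁ + 1) (N₁ - (x₁ + 1))
            * sitePoly (q ^ 2) (q ^ ρ) t (x₂ - 1) (N₂ - (x₂ - 1))))
      = dynLeft q h N₁ N₂ x₁ x₂ * (sitePoly (q ^ 2) (q ^ h) s x₁ (N₁ - x₁)
          * sitePoly (q ^ 2) (q ^ ρ) t x₂ (N₂ - x₂))
        * ((1 + q ^ h * s / q ^ 2) * (1 - q ^ N₂ * t / q ^ h)) := by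
  rcases x₂ with _ | x
  · rw [dynLeft_zero_right]; ring
  obtain rfl | hlt := hx₁.eq_or_lt
  · rw [dynLeft_full_left]; ring
  obtain ⟨y, rfl⟩ := Nat.exists_eq_add_of_le hx₂
  have lowered := sitePoly_lower (pow_ne_zero 2 hq.ne') (q ^ h) s x₁ (N₁ - (x₁ + 1))
  have move := sitePoly_move (q ^ 2) (q ^ ρ) t x y
  have upper : q ^ ρ * t * (q ^ 2) ^ x = q ^ h * (q ^ (x + 1 + y) * t) / q ^ 2 := by
    rw [eq_div_iff (pow_ne_zero 2 hq.ne')]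
    linear_combination t * hρ
  have lower : t / q ^ ρ * (q ^ 2) ^ y = q ^ (x + 1 + y) * t / q ^ h := by
    have hR := Real.rpow_pos_of_pos hq h
    have hr := Real.rpow_pos_of_pos hq ρ
    rw [div_mul_eq_mul_div, div_eq_div_iff hr.ne' hR.ne']
    refine mul_right_cancel₀ (pow_ne_zero (x + 1) (pow_ne_zero 2 hq.ne')) ?_
    linear_combination (-(q ^ (x + 1 + y) * t)) * hρ
  rw [upper, lower] at move
  rw [Nat.add_sub_cancel, show N₁ - x₁ = N₁ - (x₁ + 1) + 1 by omega,
    show x + 1 + y - x = y + 1 by omega, Nat.add_sub_cancel_left, Real.rpow_sub hq, Real.rpow_two]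
  linear_combination dynLeft q h N₁ (x + 1 + y) x₁ (x + 1) *
    ((1 + q ^ h * (q ^ (x + 1 + y) * t) / q ^ 2) * sitePoly (q ^ 2) (q ^ ρ) t x (y + 1) * lowered
      - sitePoly (q ^ 2) (q ^ h) s x₁ (N₁ - (x₁ + 1) + 1) * (1 + q ^ h * s / q ^ 2) * move)

lemma two_site_core {q M₁ M₂ a₁ a₂ R : ℝ} (hq : 0 < q) (hM₁ : 0 < M₁) (hM₂ : 0 < M₂)
    (ha₁ : 0 < a₁) (ha₂ : 0 < a₂) (hR : 0 < R) (s T : ℝ) :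
    -(q * M₂) * ((M₁ - M₁⁻¹) + s * (R * (M₁ - a₁ / M₁) - (M₁ - M₁ / a₁) / R))
        * (R / q ^ 2 * (1 - a₂⁻¹) - (1 - a₂ / M₂ ^ 2) / (R * q ^ 2)
          - T / q ^ 4 * (1 - (M₂ ^ 2)⁻¹))
      + (q * M₁)⁻¹ * ((R * (a₁ - 1) - (M₁ ^ 2 / a₁ - 1) / R) + s * (1 - M₁ ^ 2))
        * ((M₂ - M₂⁻¹) + T * (R / q ^ 2 * (M₂ / a₂ - M₂⁻¹) - (a₂ / M₂ - M₂⁻¹) / (R * q ^ 2)))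
    = (q * M₁)⁻¹ * (a₁ - 1) * (M₂ / a₂ - M₂⁻¹)
        * ((1 + M₁ ^ 2 / (R ^ 2 * a₁)) * (1 + a₂ / R ^ 2)
          / ((1 + (R ^ 2)⁻¹) * (1 + (R ^ 2)⁻¹ / q ^ 2)))
        * (R + 1 / (R * q ^ 2)) * ((1 - s / R) * (1 + R * T / q ^ 2))
      - q * M₂ * (1 - a₂⁻¹) * (M₁ - M₁⁻¹ * a₁)
        * ((1 + (a₁ * R ^ 2)⁻¹) * (1 + a₂ / (R ^ 2 * M₂ ^ 2))
          / ((1 + (R ^ 2)⁻¹) * (1 + (R ^ 2)⁻¹ * q ^ 2)))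
        * (R / q ^ 2 + 1 / R) * ((1 + R * s) * (1 - T / R / q ^ 2)) := by
  have : 0 < R ^ 2 + 1 := by positivity
  have : 0 < R ^ 2 * q ^ 2 + 1 := by positivity
  have : 0 < R ^ 2 + q ^ 2 := by positivity
  field_simp
  ring

lemma two_site_rational {q M₁ M₂ a₁ a₂ R s T : ℝ} (hq : 0 < q) (hM₁ : 0 < M₁) (hM₂ : 0 < M₂)
    (ha₁ : 0 < a₁) (ha₂ : 0 < a₂) (hR : 0 < R) (hs : s ≠ 0) (hT : T ≠ 0) :
    (s / T - 1) * (q * M₂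
        * (M₁ * ((1 + R * s) * (1 - s / R))
          - M₁⁻¹ * ((1 + R * s * a₁) * (1 - s / R * (M₁ ^ 2 / a₁))))
        * ((1 + R * T / q ^ 2) * (1 - T / R / q ^ 2)
          - (1 + R * T / a₂ / q ^ 2) * (1 - T * a₂ / (R * M₂ ^ 2) / q ^ 2)))
      + (T / s - 1) * ((q * M₁)⁻¹
        * ((1 + R * s * a₁) * (1 - s / R * (M₁ ^ 2 / a₁)) - (1 + R * s) * (1 - s / R))
        * (M₂ * ((1 + R * T / a₂ / q ^ 2) * (1 - T * a₂ / (R * M₂ ^ 2) / q ^ 2))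
          - M₂⁻¹ * ((1 + R * T / q ^ 2) * (1 - T / R / q ^ 2))))
    = (q * M₁)⁻¹ * (a₁ - 1) * (M₂ / a₂ - M₂⁻¹)
        * ((1 + M₁ ^ 2 / (R ^ 2 * a₁)) * (1 + a₂ / R ^ 2)
          / ((1 + (R ^ 2)⁻¹) * (1 + (R ^ 2)⁻¹ / q ^ 2)))
        * ((1 - s / R / q ^ 2) * (1 + R * T) - (1 + R * s) * (1 - T / R / q ^ 2))
        * ((1 - s / R) * (1 + R * T / q ^ 2))
      + q * M₂ * (1 - a₂⁻¹) * (M₁ - M₁⁻¹ * a₁)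
        * ((1 + (a₁ * R ^ 2)⁻¹) * (1 + a₂ / (R ^ 2 * M₂ ^ 2))
          / ((1 + (R ^ 2)⁻¹) * (1 + (R ^ 2)⁻¹ * q ^ 2)))
        * ((1 + R * s / q ^ 2) * (1 - T / R) - (1 - s / R) * (1 + R * T / q ^ 2))
        * ((1 + R * s) * (1 - T / R / q ^ 2)) := by
  have left₁ : M₁ * ((1 + R * s) * (1 - s / R))
      - M₁⁻¹ * ((1 + R * s * a₁) * (1 - s / R * (M₁ ^ 2 / a₁)))
      = (M₁ - M₁⁻¹) + s * (R * (M₁ - a₁ / M₁) - (M₁ - M₁ / a₁) / R) := by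
    field_simp
    ring
  have left₂ : (1 + R * T / q ^ 2) * (1 - T / R / q ^ 2)
      - (1 + R * T / a₂ / q ^ 2) * (1 - T * a₂ / (R * M₂ ^ 2) / q ^ 2)
      = T * (R / q ^ 2 * (1 - a₂⁻¹) - (1 - a₂ / M₂ ^ 2) / (R * q ^ 2)
        - T / q ^ 4 * (1 - (M₂ ^ 2)⁻¹)) := by
    field_simp
    ring
  have right₁ : (1 + R * s * a₁) * (1 - s / R * (M₁ ^ 2 / a₁)) - (1 + R * s) * (1 - s / R)
      = s * ((R * (a₁ - 1) - (M₁ ^ 2 / a₁ - 1) / R) + s * (1 - M₁ ^ 2)) := by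
    field_simp
    ring
  have right₂ : M₂ * ((1 + R * T / a₂ / q ^ 2) * (1 - T * a₂ / (R * M₂ ^ 2) / q ^ 2))
      - M₂⁻¹ * ((1 + R * T / q ^ 2) * (1 - T / R / q ^ 2))
      = (M₂ - M₂⁻¹) + T * (R / q ^ 2 * (M₂ / a₂ - M₂⁻¹) - (a₂ / M₂ - M₂⁻¹) / (R * q ^ 2)) := by
    field_simp
    ring
  have jumpRight : (1 - s / R / q ^ 2) * (1 + R * T) - (1 + R * s) * (1 - T / R / q ^ 2)
      = (R + 1 / (R * q ^ 2)) * (T - s) := by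
    field_simp
    ring
  have jumpLeft : (1 + R * s / q ^ 2) * (1 - T / R) - (1 - s / R) * (1 + R * T / q ^ 2)
      = -((R / q ^ 2 + 1 / R) * (T - s)) := by
    field_simp
    ring
  have cancelT : (s / T - 1) * T = -(T - s) := by field_simp; ring
  have cancels : (T / s - 1) * s = T - s := by field_simp
  have core := two_site_core hq hM₁ hM₂ ha₁ ha₂ hR s T
  rw [left₁, left₂, right₁, right₂, jumpRight, jumpLeft]
  generalize M₁ - M₁⁻¹ + s * _ = A₁ at core ⊢
  generalize R / q ^ 2 * _ - _ - _ = A₂ at core ⊢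
  generalize R * (a₁ - 1) - _ + _ = A₃ at core ⊢
  generalize M₂ - M₂⁻¹ + T * _ = A₄ at core ⊢
  linear_combination (T - s) * core + q * M₂ * A₁ * A₂ * cancelT + (q * M₁)⁻¹ * A₃ * A₄ * cancels

lemma sitePoly_mul_base_left {q : ℝ} (hq : 0 < q) {N₁ x₁ : ℕ} (hx₁ : x₁ ≤ N₁) (R s : ℝ) :
    (1 + R * s) * (1 - s / R) * sitePoly (q ^ 2) R (q ^ 2 * s) x₁ (N₁ - x₁)
      = sitePoly (q ^ 2) R s x₁ (N₁ - x₁)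
        * ((1 + R * s * (q ^ 2) ^ x₁) * (1 - s / R * ((q ^ N₁) ^ 2 / (q ^ 2) ^ x₁))) := by
  have holes : (q ^ N₁) ^ 2 / (q ^ 2) ^ x₁ = (q ^ 2) ^ (N₁ - x₁) := by
    rw [div_eq_iff (by positivity), ← pow_add, Nat.sub_add_cancel hx₁, pow_right_comm]
  rw [holes, sitePoly_mul_base]

lemma sitePoly_div_base_right {q : ℝ} (hq : 0 < q) {N₂ x₂ : ℕ} (hx₂ : x₂ ≤ N₂) {ρ h : ℝ}
    (hρ : q ^ ρ * (q ^ 2) ^ x₂ = q ^ h * q ^ N₂) (t : ℝ) :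
    (1 + q ^ h * (q ^ N₂ * t) / q ^ 2) * (1 - q ^ N₂ * t / q ^ h / q ^ 2)
        * sitePoly (q ^ 2) (q ^ ρ) (t / q ^ 2) x₂ (N₂ - x₂)
      = sitePoly (q ^ 2) (q ^ ρ) t x₂ (N₂ - x₂)
        * ((1 + q ^ h * (q ^ N₂ * t) / (q ^ 2) ^ x₂ / q ^ 2)
          * (1 - q ^ N₂ * t * (q ^ 2) ^ x₂ / (q ^ h * (q ^ N₂) ^ 2) / q ^ 2)) := by
  have holes : (q ^ 2) ^ (N₂ - x₂) = (q ^ N₂) ^ 2 / (q ^ 2) ^ x₂ := by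
    rw [eq_div_iff (by positivity), ← pow_add, Nat.sub_add_cancel hx₂, pow_right_comm]
  have hρ' : q ^ ρ = q ^ h * q ^ N₂ / (q ^ 2) ^ x₂ := (eq_div_iff (by positivity)).2 hρ
  have base := sitePoly_div_base (pow_ne_zero 2 hq.ne') (q ^ ρ) t x₂ (N₂ - x₂)
  have upper : q ^ ρ * t = q ^ h * (q ^ N₂ * t) / (q ^ 2) ^ x₂ := by rw [hρ']; ring
  have lower : t / q ^ ρ = q ^ N₂ * t * (q ^ 2) ^ x₂ / (q ^ h * (q ^ N₂) ^ 2) := by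
    rw [hρ']
    field_simp
  have upper' : q ^ ρ * t * (q ^ 2) ^ x₂ = q ^ h * (q ^ N₂ * t) := by linear_combination t * hρ
  have lower' : t / q ^ ρ * (q ^ 2) ^ (N₂ - x₂) = q ^ N₂ * t / q ^ h := by
    rw [lower, holes]
    field_simp
  rwa [upper', lower', upper, lower] at base

lemma sitePoly_duality {q : ℝ} (hq : 0 < q) (hq1 : q ≠ 1) {N₁ N₂ x₁ x₂ : ℕ} (hx₁ : x₁ ≤ N₁)
    (hx₂ : x₂ ≤ N₂) {ρ h : ℝ} (hρ : q ^ ρ * (q ^ 2) ^ x₂ = q ^ h * q ^ N₂) {s t : ℝ} (hs : s ≠ 0)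
    (ht : t ≠ 0) (h₁ : 1 + q ^ h * s ≠ 0) (h₂ : 1 - s / q ^ h ≠ 0)
    (h₃ : 1 - q ^ N₂ * t / q ^ h / q ^ 2 ≠ 0) (h₄ : 1 + q ^ h * (q ^ N₂ * t) / q ^ 2 ≠ 0) :
    (s / (q ^ N₂ * t) - 1)
        * (q * q ^ N₂ * (q ^ N₁ * sitePoly (q ^ 2) (q ^ h) s x₁ (N₁ - x₁)
            - (q ^ N₁)⁻¹ * sitePoly (q ^ 2) (q ^ h) (q ^ 2 * s) x₁ (N₁ - x₁))
          * (sitePoly (q ^ 2) (q ^ ρ) t x₂ (N₂ - x₂)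
            - sitePoly (q ^ 2) (q ^ ρ) (t / q ^ 2) x₂ (N₂ - x₂)) / (q - q⁻¹) ^ 2)
      + (q ^ N₂ * t / s - 1) * ((q * q ^ N₁)⁻¹
          * (sitePoly (q ^ 2) (q ^ h) (q ^ 2 * s) x₁ (N₁ - x₁)
            - sitePoly (q ^ 2) (q ^ h) s x₁ (N₁ - x₁))
          * (q ^ N₂ * sitePoly (q ^ 2) (q ^ ρ) (t / q ^ 2) x₂ (N₂ - x₂)
            - (q ^ N₂)⁻¹ * sitePoly (q ^ 2) (q ^ ρ) t x₂ (N₂ - x₂)) / (q - q⁻¹) ^ 2)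
    = dynRight q h N₁ N₂ x₁ x₂
        * (sitePoly (q ^ 2) (q ^ (h + 2)) s (x₁ - 1) (N₁ - (x₁ - 1))
            * sitePoly (q ^ 2) (q ^ ρ) t (x₂ + 1) (N₂ - (x₂ + 1))
          - sitePoly (q ^ 2) (q ^ h) s x₁ (N₁ - x₁) * sitePoly (q ^ 2) (q ^ ρ) t x₂ (N₂ - x₂))
      + dynLeft q h N₁ N₂ x₁ x₂
        * (sitePoly (q ^ 2) (q ^ (h - 2)) s (x₁ + 1) (N₁ - (x₁ + 1))
            * sitePoly (q ^ 2) (q ^ ρ) t (x₂ - 1) (N₂ - (x₂ - 1))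
          - sitePoly (q ^ 2) (q ^ h) s x₁ (N₁ - x₁)
            * sitePoly (q ^ 2) (q ^ ρ) t x₂ (N₂ - x₂)) := by
  have left := sitePoly_mul_base_left hq hx₁ (q ^ h) s
  have right := sitePoly_div_base_right hq hx₂ hρ t
  have jumpRight := dynRight_mul_sitePoly hq hx₁ hx₂ hρ s t
  have jumpLeft := dynLeft_mul_sitePoly hq hx₁ hx₂ hρ s t
  have rational := two_site_rational hq (pow_pos hq N₁) (pow_pos hq N₂)
    (pow_pos (pow_pos hq 2) x₁) (pow_pos (pow_pos hq 2) x₂) (Real.rpow_pos_of_pos hq h) hs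
    (mul_ne_zero (pow_pos hq N₂).ne' ht)
  have rateRight := dynRight_eq hq hq1 h N₁ N₂ x₁ x₂
  have rateLeft := dynLeft_eq hq hq1 h N₁ N₂ x₁ x₂
  generalize (q * q ^ N₁)⁻¹ * ((q ^ 2) ^ x₁ - 1) * _ * _ = cR at rational rateRight
  generalize q * q ^ N₂ * (1 - ((q ^ 2) ^ x₂)⁻¹) * _ * _ = cL at rational rateLeft
  generalize dynRight q h N₁ N₂ x₁ x₂ = dR at *
  generalize dynLeft q h N₁ N₂ x₁ x₂ = dL at *
  generalize sitePoly (q ^ 2) (q ^ (h + 2)) s (x₁ - 1) (N₁ - (x₁ - 1)) * _ = JR at *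
  generalize sitePoly (q ^ 2) (q ^ (h - 2)) s (x₁ + 1) (N₁ - (x₁ + 1)) * _ = JL at *
  generalize sitePoly (q ^ 2) (q ^ h) s x₁ (N₁ - x₁) = F at *
  generalize sitePoly (q ^ 2) (q ^ ρ) t x₂ (N₂ - x₂) = G at *
  generalize sitePoly (q ^ 2) (q ^ h) (q ^ 2 * s) x₁ (N₁ - x₁) = F' at *
  generalize sitePoly (q ^ 2) (q ^ ρ) (t / q ^ 2) x₂ (N₂ - x₂) = G' at *
  generalize q ^ N₂ * t = T at *
  generalize (1 + q ^ h * s * (q ^ 2) ^ x₁) * _ = A at *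
  generalize (1 + q ^ h * T / (q ^ 2) ^ x₂ / q ^ 2) * _ = B at *
  generalize (1 - s / q ^ h / q ^ 2) * (1 + q ^ h * T) = eR at *
  generalize (1 + q ^ h * s / q ^ 2) * (1 - T / q ^ h) = eL at *
  generalize 1 + q ^ h * s = d₁ at *
  generalize 1 - s / q ^ h = d₂ at *
  generalize 1 - T / q ^ h / q ^ 2 = d₃ at *
  generalize 1 + q ^ h * T / q ^ 2 = d₄ at *
  generalize q ^ N₁ = M₁ at *
  generalize q ^ N₂ = M₂ at *
  subst rateRight rateLeft
  refine mul_left_cancel₀ (mul_ne_zero (mul_ne_zero (mul_ne_zero h₁ h₂) h₃) h₄) ?_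
  linear_combination F * G / (q - q⁻¹) ^ 2 * rational - d₂ * d₄ * jumpRight - d₁ * d₃ * jumpLeft
    + ((T / s - 1) * (q * M₁)⁻¹ * (M₂ * G' - M₂⁻¹ * G)
        - (s / T - 1) * (q * M₂) * M₁⁻¹ * (G - G')) * (d₃ * d₄) / (q - q⁻¹) ^ 2 * left
    + F * ((T / s - 1) * (q * M₁)⁻¹ * (A - d₁ * d₂) * M₂
        - (s / T - 1) * (q * M₂) * (M₁ * (d₁ * d₂) - M₁⁻¹ * A)) / (q - q⁻¹) ^ 2 * right

lemma pairGF_kSite {q : ℝ} (hq : 0 < q) (hq1 : q ≠ 1) {N₁ N₂ x₁ x₂ : ℕ} (hx₁ : x₁ ≤ N₁)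
    (hx₂ : x₂ ≤ N₂) (h ρ s t : ℝ) :
    pairGF q N₁ N₂ (fun a b => kSite a x₁ h N₁ q * kSite b x₂ ρ N₂ q) s t
      = sitePoly (q ^ 2) (q ^ h) (q ^ ((1 - (N₁ : ℝ)) / 2) * s) x₁ (N₁ - x₁)
        * sitePoly (q ^ 2) (q ^ ρ) (q ^ ((1 - (N₂ : ℝ)) / 2) * t) x₂ (N₂ - x₂) := by
  rw [pairGF_mul, siteGF_kSite hq hq1 hx₁, siteGF_kSite hq hq1 hx₂]

lemma pairGF_dynRight {q : ℝ} (hq : 0 < q) (hq1 : q ≠ 1) {N₁ N₂ x₁ x₂ : ℕ} (hx₁ : x₁ ≤ N₁)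
    (hx₂ : x₂ ≤ N₂) (h ρ s t : ℝ) :
    pairGF q N₁ N₂ (fun a b => dynRight q h N₁ N₂ x₁ x₂
        * (kSite a (x₁ - 1) (h + 2) N₁ q * kSite b (x₂ + 1) ρ N₂ q
          - kSite a x₁ h N₁ q * kSite b x₂ ρ N₂ q)) s t
      = dynRight q h N₁ N₂ x₁ x₂
        * (sitePoly (q ^ 2) (q ^ (h + 2)) (q ^ ((1 - (N₁ : ℝ)) / 2) * s) (x₁ - 1)
              (N₁ - (x₁ - 1))
            * sitePoly (q ^ 2) (q ^ ρ) (q ^ ((1 - (N₂ : ℝ)) / 2) * t) (x₂ + 1) (N₂ - (x₂ + 1))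
          - sitePoly (q ^ 2) (q ^ h) (q ^ ((1 - (N₁ : ℝ)) / 2) * s) x₁ (N₁ - x₁)
            * sitePoly (q ^ 2) (q ^ ρ) (q ^ ((1 - (N₂ : ℝ)) / 2) * t) x₂ (N₂ - x₂)) := by
  rw [pairGF_const_mul, pairGF_sub]
  obtain rfl | hlt := hx₂.eq_or_lt
  · simp only [dynRight_full_right, zero_mul]
  · rw [pairGF_kSite hq hq1 ((Nat.sub_le x₁ 1).trans hx₁) hlt, pairGF_kSite hq hq1 hx₁ hx₂]

lemma pairGF_dynLeft {q : ℝ} (hq : 0 < q) (hq1 : q ≠ 1) {N₁ N₂ x₁ x₂ : ℕ} (hx₁ : x₁ ≤ N₁)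
    (hx₂ : x₂ ≤ N₂) (h ρ s t : ℝ) :
    pairGF q N₁ N₂ (fun a b => dynLeft q h N₁ N₂ x₁ x₂
        * (kSite a (x₁ + 1) (h - 2) N₁ q * kSite b (x₂ - 1) ρ N₂ q
          - kSite a x₁ h N₁ q * kSite b x₂ ρ N₂ q)) s t
      = dynLeft q h N₁ N₂ x₁ x₂
        * (sitePoly (q ^ 2) (q ^ (h - 2)) (q ^ ((1 - (N₁ : ℝ)) / 2) * s) (x₁ + 1)
              (N₁ - (x₁ + 1))
            * sitePoly (q ^ 2) (q ^ ρ) (q ^ ((1 - (N₂ : ℝ)) / 2) * t) (x₂ - 1) (N₂ - (x₂ - 1))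
          - sitePoly (q ^ 2) (q ^ h) (q ^ ((1 - (N₁ : ℝ)) / 2) * s) x₁ (N₁ - x₁)
            * sitePoly (q ^ 2) (q ^ ρ) (q ^ ((1 - (N₂ : ℝ)) / 2) * t) x₂ (N₂ - x₂)) := by
  rw [pairGF_const_mul, pairGF_sub]
  obtain rfl | hlt := hx₁.eq_or_lt
  · simp only [dynLeft_full_left, zero_mul]
  · rw [pairGF_kSite hq hq1 hlt ((Nat.sub_le x₂ 1).trans hx₂), pairGF_kSite hq hq1 hx₁ hx₂]

lemma eventually_one_sub_mul_ne_zero (c : ℝ) : ∀ᶠ s in cofinite, 1 - c * s ≠ 0 := by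
  refine (eventually_cofinite_ne c⁻¹).mono fun s hs h => hs ?_
  exact eq_inv_of_mul_eq_one_right (sub_eq_zero.1 h).symm

lemma pairGF_bondOp_kSite {q : ℝ} (hq : 0 < q) (hq1 : q ≠ 1) (N₁ N₂ x₁ x₂ : ℕ) (h ρ : ℝ)
    {s t : ℝ} (hs : s ≠ 0) (ht : t ≠ 0) :
    pairGF q N₁ N₂ (bondOp q N₁ N₂ (q ^ (((N₁ : ℝ) + N₂) / 2)) (fun n => kSite n x₁ h N₁ q)
        (fun n => kSite n x₂ ρ N₂ q)) s t
      = (q ^ ((1 - (N₁ : ℝ)) / 2) * s / (q ^ N₂ * (q ^ ((1 - (N₂ : ℝ)) / 2) * t)) - 1)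
          * pairGF q N₁ N₂
            (fun a b => rateLeft q N₁ N₂ a b * (kSite a x₁ h N₁ q * kSite b x₂ ρ N₂ q)) s t
        + (q ^ N₂ * (q ^ ((1 - (N₂ : ℝ)) / 2) * t) / (q ^ ((1 - (N₁ : ℝ)) / 2) * s) - 1)
          * pairGF q N₁ N₂
            (fun a b => rateRight q N₁ N₂ a b * (kSite a x₁ h N₁ q * kSite b x₂ ρ N₂ q)) s t := by
  have square : (q ^ (((N₁ : ℝ) + N₂) / 2)) ^ 2 = q ^ N₁ * q ^ N₂ := by
    rw [← rpow_two_mul hq, mul_div_cancel₀ _ two_ne_zero, Real.rpow_add hq, Real.rpow_natCast,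
      Real.rpow_natCast]
  have scale : q ^ N₂ * q ^ ((1 - (N₂ : ℝ)) / 2)
      = q ^ ((1 - (N₁ : ℝ)) / 2) * q ^ (((N₁ : ℝ) + N₂) / 2) := by
    rw [← Real.rpow_natCast, ← Real.rpow_add hq, ← Real.rpow_add hq]
    ring_nf
  have hg := (Real.rpow_pos_of_pos hq ((1 - (N₁ : ℝ)) / 2)).ne'
  rw [pairGF_bondOp hq hq1 N₁ N₂ square _ _ hs ht, ← mul_assoc (q ^ N₂), scale,
    mul_assoc _ (q ^ (((N₁ : ℝ) + N₂) / 2)), mul_div_mul_left _ _ hg, mul_div_mul_left _ _ hg]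

lemma two_site_duality {q : ℝ} (hq : 0 < q) (hq1 : q ≠ 1) {N₁ N₂ x₁ x₂ : ℕ} (hx₁ : x₁ ≤ N₁)
    (hx₂ : x₂ ≤ N₂) {ρ h : ℝ} (hh : h = ρ + (2 * x₂ - N₂)) {a b : ℕ} (ha : a ≤ N₁)
    (hb : b ≤ N₂) :
    bondOp q N₁ N₂ (q ^ (((N₁ : ℝ) + N₂) / 2)) (fun n => kSite n x₁ h N₁ q)
        (fun n => kSite n x₂ ρ N₂ q) a b
      = dynRight q h N₁ N₂ x₁ x₂ * (kSite a (x₁ - 1) (h + 2) N₁ q * kSite b (x₂ + 1) ρ N₂ q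
          - kSite a x₁ h N₁ q * kSite b x₂ ρ N₂ q)
        + dynLeft q h N₁ N₂ x₁ x₂ * (kSite a (x₁ + 1) (h - 2) N₁ q * kSite b (x₂ - 1) ρ N₂ q
          - kSite a x₁ h N₁ q * kSite b x₂ ρ N₂ q) := by
  have hρ : q ^ ρ * (q ^ 2) ^ x₂ = q ^ h * q ^ N₂ := by
    rw [pow_right_comm, ← Real.rpow_natCast q x₂, ← rpow_two_mul hq, ← Real.rpow_natCast q N₂,
      ← Real.rpow_add hq, ← Real.rpow_add hq, hh]
    ring_nf
  have hg₁ := (Real.rpow_pos_of_pos hq ((1 - (N₁ : ℝ)) / 2)).ne'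
  have hg₂ := (Real.rpow_pos_of_pos hq ((1 - (N₂ : ℝ)) / 2)).ne'
  refine eq_of_eventually_pairGF_eq hq hq1
    (ψ := fun a b =>
      dynRight q h N₁ N₂ x₁ x₂ * (kSite a (x₁ - 1) (h + 2) N₁ q * kSite b (x₂ + 1) ρ N₂ q
          - kSite a x₁ h N₁ q * kSite b x₂ ρ N₂ q)
        + dynLeft q h N₁ N₂ x₁ x₂ * (kSite a (x₁ + 1) (h - 2) N₁ q * kSite b (x₂ - 1) ρ N₂ q
          - kSite a x₁ h N₁ q * kSite b x₂ ρ N₂ q)) ?_ ha hb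
  filter_upwards [eventually_cofinite_ne 0,
    eventually_one_sub_mul_ne_zero (-(q ^ h * q ^ ((1 - (N₁ : ℝ)) / 2))),
    eventually_one_sub_mul_ne_zero (q ^ ((1 - (N₁ : ℝ)) / 2) / q ^ h)] with s hs h₁ h₂
  filter_upwards [eventually_cofinite_ne 0,
    eventually_one_sub_mul_ne_zero (q ^ N₂ * q ^ ((1 - (N₂ : ℝ)) / 2) / q ^ h / q ^ 2),
    eventually_one_sub_mul_ne_zero (-(q ^ h * (q ^ N₂ * q ^ ((1 - (N₂ : ℝ)) / 2)) / q ^ 2))]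
    with t ht h₃ h₄
  rw [pairGF_bondOp_kSite hq hq1 N₁ N₂ x₁ x₂ h ρ hs ht, pairGF_rateLeft hq hq1,
    pairGF_rateRight hq hq1, siteGF_kSite hq hq1 hx₁, siteGF_kSite hq hq1 hx₁,
    siteGF_kSite hq hq1 hx₂, siteGF_kSite hq hq1 hx₂, mul_left_comm _ (q ^ 2) s,
    ← mul_div_assoc _ t, pairGF_add, pairGF_dynRight hq hq1 hx₁ hx₂, pairGF_dynLeft hq hq1 hx₁ hx₂]
  exact sitePoly_duality hq hq1 hx₁ hx₂ hρ (mul_ne_zero hg₁ hs) (mul_ne_zero hg₂ ht)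
    (by convert h₁ using 1; ring) (by convert h₂ using 1; ring)
    (by convert h₃ using 1; ring) (by convert h₄ using 1; ring)

/-! ### Jumps of configurations -/

@[to_additive]
lemma prod_eq_mul_mul_prod_erase {ι M : Type*} [Fintype ι] [DecidableEq ι] [CommMonoid M]
    {i j : ι} (hij : i ≠ j) (f : ι → M) :
    ∏ l, f l = f i * f j * ∏ l ∈ (Finset.univ.erase i).erase j, f l := by
  rw [← Finset.mul_prod_erase _ f (Finset.mem_univ i),
    ← Finset.mul_prod_erase _ f (Finset.mem_erase.2 ⟨hij.symm, Finset.mem_univ j⟩), mul_assoc]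

lemma sum_ite_or_eq {ι M : Type*} [Fintype ι] [AddCommMonoid M] {P Q : ι → Prop}
    [DecidablePred P] [DecidablePred Q] {i : ι} (hi : ¬ P i) (hQ : ∀ l, Q l ↔ l = i ∨ P l)
    (f : ι → M) : ∑ l, (if Q l then f l else 0) = f i + ∑ l, (if P l then f l else 0) := by
  classical
  have : Finset.univ.filter Q = insert i (Finset.univ.filter P) := by
    ext l
    simp only [Finset.mem_filter, Finset.mem_insert, Finset.mem_univ, true_and, hQ]
  rw [← Finset.sum_filter, ← Finset.sum_filter, this, Finset.sum_insert (by simpa using hi)]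

section Jump

variable {m : ℕ} {N : Fin (m + 1) → ℕ} {η : Config N} {i j : Fin (m + 1)}

/-- A particle of `η` can move from `i` to `j`: the site `i` is occupied and `j` is not full. -/
abbrev CanJump (η : Config N) (i j : Fin (m + 1)) : Prop := 0 < (η i : ℕ) ∧ (η j : ℕ) < N j

lemma config_le (η : Config N) (i : Fin (m + 1)) : (η i : ℕ) ≤ N i := Nat.lt_succ_iff.1 (η i).isLt

lemma jump_target (h : CanJump η i j) : (jump η i j j : ℕ) = η j + 1 := by
  rw [jump, dif_pos h, Function.update_self]

lemma jump_source (hij : i ≠ j) (h : CanJump η i j) : (jump η i j i : ℕ) = η i - 1 := by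
  rw [jump, dif_pos h, Function.update_of_ne hij, Function.update_self]

lemma jump_of_ne {l : Fin (m + 1)} (hi : l ≠ i) (hj : l ≠ j) : jump η i j l = η l := by
  rw [jump]
  split_ifs
  · rw [Function.update_of_ne hj, Function.update_of_ne hi]
  · rfl

lemma canJump_jump (hij : i ≠ j) (h : CanJump η i j) : CanJump (jump η i j) j i := by
  rw [CanJump, jump_target h, jump_source hij h]
  have := config_le η i
  omega

lemma jump_jump (hij : i ≠ j) (h : CanJump η i j) : jump (jump η i j) j i = η := by
  have back := canJump_jump hij h
  funext l
  apply Fin.ext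
  obtain rfl | hi := eq_or_ne l i
  · rw [jump_target back, jump_source hij h, Nat.sub_add_cancel h.1]
  obtain rfl | hj := eq_or_ne l j
  · rw [jump_source hij.symm back, jump_target h, Nat.add_sub_cancel]
  · rw [jump_of_ne hj hi, jump_of_ne hi hj]

@[to_additive]
lemma prod_jump {M : Type*} [CommMonoid M] (hij : i ≠ j) (h : CanJump η i j)
    (F : Fin (m + 1) → ℕ → M) :
    ∏ l, F l (jump η i j l)
      = F i (η i - 1) * F j (η j + 1) * ∏ l ∈ (Finset.univ.erase i).erase j, F l (η l) := by
  rw [prod_eq_mul_mul_prod_erase hij, jump_target h, jump_source hij h]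
  congr 1
  refine Finset.prod_congr rfl fun l hl => ?_
  rw [jump_of_ne (Finset.ne_of_mem_erase (Finset.mem_of_mem_erase hl))
    (Finset.ne_of_mem_erase hl)]

lemma total_jump (hij : i ≠ j) (h : CanJump η i j) : total (jump η i j) = total η := by
  rw [total, total, sum_jump hij h fun _ n => n, sum_eq_add_add_sum_erase hij]
  omega

lemma hPlus_jump (hij : i ≠ j) (h : CanJump η i j) (ρ : ℝ) (k : ℕ) :
    hPlus ρ (jump η i j) k
      = hPlus ρ η k + (if k ≤ (j : ℕ) + 1 then 2 else 0) - (if k ≤ (i : ℕ) + 1 then 2 else 0) := by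
  rw [hPlus, hPlus, sum_jump hij h fun l n => if k ≤ (l : ℕ) + 1 then 2 * (n : ℝ) - N l else 0,
    sum_eq_add_add_sum_erase hij, Nat.cast_pred h.1, Nat.cast_succ]
  split_ifs <;> ring

lemma hMinus_jump (hij : i ≠ j) (h : CanJump η i j) (lam : ℝ) (k : ℕ) :
    hMinus lam (jump η i j) k
      = hMinus lam η k + (if (j : ℕ) + 1 ≤ k then 2 else 0)
        - (if (i : ℕ) + 1 ≤ k then 2 else 0) := by
  rw [hMinus, hMinus, sum_jump hij h fun l n => if (l : ℕ) + 1 ≤ k then 2 * (n : ℝ) - N l else 0,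
    sum_eq_add_add_sum_erase hij, Nat.cast_pred h.1, Nat.cast_succ]
  split_ifs <;> ring

lemma hPlus_succ (ρ : ℝ) (ξ : Config N) (i : Fin (m + 1)) :
    hPlus ρ ξ ((i : ℕ) + 1) = hPlus ρ ξ ((i : ℕ) + 2) + (2 * ((ξ i : ℕ) : ℝ) - N i) := by
  rw [hPlus, hPlus, sum_ite_or_eq (P := fun l : Fin (m + 1) => (i : ℕ) + 2 ≤ (l : ℕ) + 1) (i := i)
    (by omega) (fun l => by rw [Fin.ext_iff]; omega)]
  ring

lemma hMinus_succ (lam : ℝ) (ζ : Config N) (i : Fin (m + 1)) :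
    hMinus lam ζ ((i : ℕ) + 1) = hMinus lam ζ i + (2 * ((ζ i : ℕ) : ℝ) - N i) := by
  rw [hMinus, hMinus, sum_ite_or_eq (P := fun l : Fin (m + 1) => (l : ℕ) + 1 ≤ i) (i := i)
    (by omega) (fun l => by rw [Fin.ext_iff]; omega)]
  ring

end Jump

section Bond

variable {m : ℕ} {N : Fin (m + 1) → ℕ} {b : Fin m}

lemma castSucc_ne_succ (b : Fin m) : b.castSucc ≠ b.succ := Fin.castSucc_lt_succ.ne

lemma hPlus_jump_right {ξ : Config N} (h : CanJump ξ b.castSucc b.succ) (ρ : ℝ) :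
    (fun l : Fin (m + 1) => hPlus ρ (jump ξ b.castSucc b.succ) ((l : ℕ) + 2))
      = Function.update (fun l : Fin (m + 1) => hPlus ρ ξ ((l : ℕ) + 2)) b.castSucc
          (hPlus ρ ξ ((b.castSucc : ℕ) + 2) + 2) := by
  funext l
  rw [hPlus_jump (castSucc_ne_succ b) h, Function.update_apply]
  grind [Fin.val_castSucc]

lemma hPlus_jump_left {ξ : Config N} (h : CanJump ξ b.succ b.castSucc) (ρ : ℝ) :
    (fun l : Fin (m + 1) => hPlus ρ (jump ξ b.succ b.castSucc) ((l : ℕ) + 2))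
      = Function.update (fun l : Fin (m + 1) => hPlus ρ ξ ((l : ℕ) + 2)) b.castSucc
          (hPlus ρ ξ ((b.castSucc : ℕ) + 2) - 2) := by
  funext l
  rw [hPlus_jump (castSucc_ne_succ b).symm h, Function.update_apply]
  grind [Fin.val_castSucc]

lemma hMinus_jump_right {ζ : Config N} (h : CanJump ζ b.castSucc b.succ) (lam : ℝ) :
    (fun l : Fin (m + 1) => hMinus lam (jump ζ b.castSucc b.succ) l)
      = Function.update (fun l : Fin (m + 1) => hMinus lam ζ l) b.succ
          (hMinus lam ζ (b.succ : ℕ) - 2) := by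
  funext l
  rw [hMinus_jump (castSucc_ne_succ b) h, Function.update_apply]
  grind [Fin.val_castSucc]

lemma hMinus_jump_left {ζ : Config N} (h : CanJump ζ b.succ b.castSucc) (lam : ℝ) :
    (fun l : Fin (m + 1) => hMinus lam (jump ζ b.succ b.castSucc) l)
      = Function.update (fun l : Fin (m + 1) => hMinus lam ζ l) b.succ
          (hMinus lam ζ (b.succ : ℕ) + 2) := by
  funext l
  rw [hMinus_jump (castSucc_ne_succ b).symm h, Function.update_apply]
  grind [Fin.val_castSucc]

lemma uExp_jump_right {η : Config N} (h : CanJump η b.castSucc b.succ) :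
    uExp (jump η b.castSucc b.succ) = uExp η - ((N b.castSucc : ℝ) + N b.succ) := by
  have hij := castSucc_ne_succ b
  have capacity : ∑ j, (if j ≤ b.succ then (N j : ℝ) else 0)
      = N b.succ + ∑ j, if j ≤ b.castSucc then (N j : ℝ) else 0 :=
    sum_ite_or_eq (P := fun l => l ≤ b.castSucc) (i := b.succ) Fin.castSucc_lt_succ.not_ge
      (fun l => by rw [Fin.ext_iff, Fin.le_def, Fin.le_def, Fin.val_succ, Fin.val_castSucc]; omega)
      fun j => (N j : ℝ)
  let F : Fin (m + 1) → ℕ → ℝ := fun l n =>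
    (n : ℝ) * N l - 2 * (n : ℝ) * ∑ j, if j ≤ l then (N j : ℝ) else 0
  have before : uExp η = _ := sum_eq_add_add_sum_erase hij fun l => F l (η l)
  have after : uExp (jump η b.castSucc b.succ) = _ := sum_jump hij h F
  simp only [F, capacity, Nat.cast_pred h.1, Nat.cast_succ] at before after
  rw [before, after]
  ring

lemma uExp_jump_left {η : Config N} (h : CanJump η b.succ b.castSucc) :
    uExp (jump η b.succ b.castSucc) = uExp η + ((N b.castSucc : ℝ) + N b.succ) := by
  have hji := (castSucc_ne_succ b).symm
  rw [← sub_eq_iff_eq_add, ← uExp_jump_right (canJump_jump hji h), jump_jump hji h]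

end Bond

/-! ### Reversibility of the asymmetric exclusion process -/

section Reversibility

variable {m : ℕ} {N : Fin (m + 1) → ℕ} {η : Config N} {i j : Fin (m + 1)}

lemma rateRight_of_not_canJump (q : ℝ) (h : ¬ CanJump η i j) :
    rateRight q (N i) (N j) (η i) (η j) = 0 := by
  rcases not_and_or.1 h with empty | full
  · rw [Nat.eq_zero_of_not_pos empty, rateRight_zero_left]
  · rw [(config_le η j).antisymm (not_lt.1 full), rateRight_full_right]

lemma rateLeft_of_not_canJump (q : ℝ) (h : ¬ CanJump η j i) :
    rateLeft q (N i) (N j) (η i) (η j) = 0 := by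
  rcases not_and_or.1 h with empty | full
  · rw [Nat.eq_zero_of_not_pos empty, rateLeft_zero_right]
  · rw [(config_le η i).antisymm (not_lt.1 full), rateLeft_full_left]

lemma cPlus_eq_rateRight (q : ℝ) (η : Config N) (i j : Fin (m + 1)) :
    cPlus q η i j = rateRight q (N i) (N j) (η i) (η j) := rfl

lemma cMinus_eq_rateLeft (q : ℝ) (η : Config N) (i j : Fin (m + 1)) :
    cMinus q η j i = rateLeft q (N i) (N j) (η i) (η j) := rfl

/-- The reversible measure `w(η) (-v)^|η|` of the asymmetric exclusion process; it is signed if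
`v > 0`. -/
def revWeight (q v : ℝ) (η : Config N) : ℝ := wConfig q η * (-v) ^ total η

lemma detailed_balance {q : ℝ} (hq : 0 < q) (hq1 : q ≠ 1) (v : ℝ) {b : Fin m}
    (h : CanJump η b.castSucc b.succ) :
    revWeight q v η * cPlus q η b.castSucc b.succ
      = revWeight q v (jump η b.castSucc b.succ)
        * cMinus q (jump η b.castSucc b.succ) b.succ b.castSucc := by
  have hij := castSucc_ne_succ b
  have balance := wSite_mul_rateRight hq hq1 (N₁ := N b.castSucc) (N₂ := N b.succ)
    (a := (η b.castSucc : ℕ) - 1) (b := η b.succ)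
    (by have := config_le η b.castSucc; have := h.1; omega) h.2
  rw [Nat.sub_add_cancel h.1, mul_comm, ← eq_div_iff (by positivity)] at balance
  rw [revWeight, revWeight, wConfig, wConfig, total_jump hij h, uExp_jump_right h,
    prod_eq_mul_mul_prod_erase hij, prod_jump hij h fun l n => wSite n (N l) q,
    cPlus_eq_rateRight, cMinus_eq_rateLeft, jump_target h, jump_source hij h, Real.rpow_sub hq,
    Real.rpow_add hq, Real.rpow_natCast, Real.rpow_natCast]
  linear_combination (q ^ uExp η * (∏ l ∈ (Finset.univ.erase b.castSucc).erase b.succ,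
    wSite (η l) (N l) q) * (-v) ^ total η) * balance

lemma sum_cPlus_eq_sum_cMinus {q : ℝ} (hq : 0 < q) (hq1 : q ≠ 1) (v : ℝ) (b : Fin m)
    (f g : Config N → ℝ) :
    ∑ η, revWeight q v η * cPlus q η b.castSucc b.succ * (f (jump η b.castSucc b.succ) * g η)
      = ∑ η, revWeight q v η * cMinus q η b.succ b.castSucc
        * (f η * g (jump η b.succ b.castSucc)) := by
  have hij := castSucc_ne_succ b
  rw [← Finset.sum_filter_of_ne (p := fun η : Config N => CanJump η b.castSucc b.succ),
    ← Finset.sum_filter_of_ne (s := Finset.univ) (f := fun η : Config N =>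
        revWeight q v η * cMinus q η b.succ b.castSucc * (f η * g (jump η b.succ b.castSucc)))
      (p := fun η : Config N => CanJump η b.succ b.castSucc)]
  · refine Finset.sum_nbij' (fun η => jump η b.castSucc b.succ) (fun η => jump η b.succ b.castSucc)
      ?_ ?_ ?_ ?_ ?_ <;>
      simp only [Finset.mem_filter, Finset.mem_univ, true_and] <;> intro η hη
    · exact canJump_jump hij hη
    · exact canJump_jump hij.symm hη
    · exact jump_jump hij hη
    · exact jump_jump hij.symm hη
    · rw [detailed_balance hq hq1 v hη, jump_jump hij hη]
  · intro η _ nonzero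
    by_contra h
    rw [cMinus_eq_rateLeft, rateLeft_of_not_canJump q h, mul_zero, zero_mul] at nonzero
    exact nonzero rfl
  · intro η _ nonzero
    by_contra h
    rw [cPlus_eq_rateRight, rateRight_of_not_canJump q h, mul_zero, zero_mul] at nonzero
    exact nonzero rfl

/-- The part of the generator of the asymmetric exclusion process that belongs to the bond `b`. -/
def bondGen (q : ℝ) (b : Fin m) (f : Config N → ℝ) (η : Config N) : ℝ :=
  cPlus q η b.castSucc b.succ * (f (jump η b.castSucc b.succ) - f η)
    + cMinus q η b.succ b.castSucc * (f (jump η b.succ b.castSucc) - f η)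

lemma sum_bondGen_mul {q : ℝ} (hq : 0 < q) (hq1 : q ≠ 1) (v : ℝ) (b : Fin m)
    (f g : Config N → ℝ) :
    ∑ η, revWeight q v η * (bondGen q b f η * g η)
      = ∑ η, revWeight q v η * (f η * bondGen q b g η) := by
  have forward := sum_cPlus_eq_sum_cMinus hq hq1 v b f g
  have backward := sum_cPlus_eq_sum_cMinus hq hq1 v b g f
  have expand : ∀ f g : Config N → ℝ, ∑ η, revWeight q v η * (bondGen q b f η * g η)
      = (∑ η, revWeight q v η * cPlus q η b.castSucc b.succ * (f (jump η b.castSucc b.succ) * g η))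
        + (∑ η, revWeight q v η * cMinus q η b.succ b.castSucc
            * (g η * f (jump η b.succ b.castSucc)))
        - ∑ η, revWeight q v η * (cPlus q η b.castSucc b.succ + cMinus q η b.succ b.castSucc)
            * (f η * g η) := by
    intro f g
    rw [← Finset.sum_add_distrib, ← Finset.sum_sub_distrib]
    exact Finset.sum_congr rfl fun η _ => by rw [bondGen]; ring
  simp only [mul_comm (f _) (bondGen q b g _)]
  rw [expand f g, expand g f, forward, backward, add_comm]
  simp only [mul_comm (f _) (g _)]

end Reversibility

/-! ### Duality with the asymmetric exclusion process on one bond -/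

section Duality

variable {m : ℕ} {N : Fin (m + 1) → ℕ}

/-- The common form `q^{-u(η)/2} ∏_l k(η_l, ξ_l; h_l; N_l; p)` of `K_R` (base `p = q`) and `K_L`
(base `p = q⁻¹`). -/
def krawtchoukProd (q p : ℝ) (h : Fin (m + 1) → ℝ) (η ξ : Config N) : ℝ :=
  q ^ (-(1 / 2) * uExp η) * ∏ l, kSite (η l) (ξ l) (h l) (N l) p

/-- The factor of `krawtchoukProd` that a jump of `ξ` between the sites `i` and `j` preserves. -/
def krawtchoukRest (q p : ℝ) (h : Fin (m + 1) → ℝ) (i j : Fin (m + 1)) (η ξ : Config N) : ℝ :=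
  q ^ (-(1 / 2) * uExp η)
    * ∏ l ∈ (Finset.univ.erase i).erase j, kSite (η l) (ξ l) (h l) (N l) p

lemma KR_eq_krawtchoukProd (q ρ : ℝ) (η ξ : Config N) :
    KR q ρ η ξ = krawtchoukProd q q (fun l => hPlus ρ ξ ((l : ℕ) + 2)) η ξ := rfl

lemma KL_eq_krawtchoukProd (q lam : ℝ) (η ζ : Config N) :
    KL q lam η ζ = krawtchoukProd q q⁻¹ (fun l => hMinus lam ζ (l : ℕ)) η ζ := rfl

lemma krawtchoukRest_comm (q p : ℝ) (h : Fin (m + 1) → ℝ) (i j : Fin (m + 1)) (η ξ : Config N) :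
    krawtchoukRest q p h i j η ξ = krawtchoukRest q p h j i η ξ := by
  rw [krawtchoukRest, krawtchoukRest, Finset.erase_right_comm]

section

variable {i j : Fin (m + 1)} {η ξ : Config N}

lemma krawtchoukProd_eq_mul (hij : i ≠ j) (q p : ℝ) (h : Fin (m + 1) → ℝ) (η ξ : Config N) :
    krawtchoukProd q p h η ξ = krawtchoukRest q p h i j η ξ
      * (kSite (η i) (ξ i) (h i) (N i) p * kSite (η j) (ξ j) (h j) (N j) p) := by
  rw [krawtchoukProd, krawtchoukRest, prod_eq_mul_mul_prod_erase hij]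
  ring

lemma krawtchoukProd_jump_left_arg (hij : i ≠ j) (hη : CanJump η i j) (q p : ℝ)
    (h : Fin (m + 1) → ℝ) (ξ : Config N) :
    krawtchoukProd q p h (jump η i j) ξ
      = q ^ (-(1 / 2) * uExp (jump η i j)) * (kSite (η i - 1) (ξ i) (h i) (N i) p
        * kSite (η j + 1) (ξ j) (h j) (N j) p
        * ∏ l ∈ (Finset.univ.erase i).erase j, kSite (η l) (ξ l) (h l) (N l) p) := by
  rw [krawtchoukProd, prod_jump hij hη fun l n => kSite n (ξ l) (h l) (N l) p]

lemma prod_erase_erase_update {α : Type*} (F : Fin (m + 1) → α → ℝ) (h : Fin (m + 1) → α) (c : α) :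
    ∏ l ∈ (Finset.univ.erase i).erase j, F l (Function.update h i c l)
      = ∏ l ∈ (Finset.univ.erase i).erase j, F l (h l) :=
  Finset.prod_congr rfl fun l hl => by
    rw [Function.update_of_ne (Finset.ne_of_mem_erase (Finset.mem_of_mem_erase hl))]

lemma krawtchoukProd_jump_source (hij : i ≠ j) (hξ : CanJump ξ i j) (q p : ℝ)
    (h : Fin (m + 1) → ℝ) (c : ℝ) (η : Config N) :
    krawtchoukProd q p (Function.update h i c) η (jump ξ i j)
      = krawtchoukRest q p h i j η ξ
        * (kSite (η i) (ξ i - 1) c (N i) p * kSite (η j) (ξ j + 1) (h j) (N j) p) := by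
  rw [krawtchoukProd, krawtchoukRest,
    prod_jump hij hξ fun l n => kSite (η l) n (Function.update h i c l) (N l) p,
    Function.update_self, Function.update_of_ne hij.symm,
    prod_erase_erase_update fun l a => kSite (η l) (ξ l) a (N l) p]
  ring

lemma krawtchoukProd_jump_target (hij : i ≠ j) (hξ : CanJump ξ j i) (q p : ℝ)
    (h : Fin (m + 1) → ℝ) (c : ℝ) (η : Config N) :
    krawtchoukProd q p (Function.update h i c) η (jump ξ j i)
      = krawtchoukRest q p h i j η ξ
        * (kSite (η i) (ξ i + 1) c (N i) p * kSite (η j) (ξ j - 1) (h j) (N j) p) := by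
  rw [krawtchoukProd, krawtchoukRest,
    prod_jump hij.symm hξ fun l n => kSite (η l) n (Function.update h i c l) (N l) p,
    Function.update_self, Function.update_of_ne hij.symm, Finset.erase_right_comm,
    prod_erase_erase_update fun l a => kSite (η l) (ξ l) a (N l) p]
  ring

lemma bondOp_kSite_mul_krawtchoukRest (q : ℝ) {p : ℝ} (hp : 0 < p) (hp1 : p ≠ 1) (hij : i ≠ j)
    (H : Config N → Fin (m + 1) → ℝ) (hstep : H ξ i = H ξ j + (2 * ((ξ j : ℕ) : ℝ) - N j))
    (hsource : CanJump ξ i j → H (jump ξ i j) = Function.update (H ξ) i (H ξ i + 2))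
    (htarget : CanJump ξ j i → H (jump ξ j i) = Function.update (H ξ) i (H ξ i - 2)) :
    bondOp p (N i) (N j) (p ^ (((N i : ℝ) + N j) / 2)) (fun n => kSite n (ξ i) (H ξ i) (N i) p)
        (fun n => kSite n (ξ j) (H ξ j) (N j) p) (η i) (η j) * krawtchoukRest q p (H ξ) i j η ξ
      = dynRight p (H ξ i) (N i) (N j) (ξ i) (ξ j) * (krawtchoukProd q p (H (jump ξ i j)) η
          (jump ξ i j) - krawtchoukProd q p (H ξ) η ξ)
        + dynLeft p (H ξ i) (N i) (N j) (ξ i) (ξ j) * (krawtchoukProd q p (H (jump ξ j i)) η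
          (jump ξ j i) - krawtchoukProd q p (H ξ) η ξ) := by
  rw [two_site_duality hp hp1 (config_le ξ i) (config_le ξ j) hstep (config_le η i) (config_le η j),
    add_mul, krawtchoukProd_eq_mul hij q p (H ξ) η ξ]
  congr 1
  · by_cases h : CanJump ξ i j
    · rw [hsource h, krawtchoukProd_jump_source hij h]
      ring
    · rw [dynRight, rateRight_of_not_canJump p h]
      ring
  · by_cases h : CanJump ξ j i
    · rw [htarget h, krawtchoukProd_jump_target hij h]
      ring
    · rw [dynLeft, rateLeft_of_not_canJump p h]
      ring

end

lemma bondGen_krawtchoukProd {q : ℝ} (hq : 0 < q) (p : ℝ) (h : Fin (m + 1) → ℝ) (b : Fin m)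
    (η ξ : Config N) :
    bondGen q b (fun η => krawtchoukProd q p h η ξ) η
      = bondOp q (N b.castSucc) (N b.succ) (q ^ (((N b.castSucc : ℝ) + N b.succ) / 2))
          (fun n => kSite n (ξ b.castSucc) (h b.castSucc) (N b.castSucc) p)
          (fun n => kSite n (ξ b.succ) (h b.succ) (N b.succ) p) (η b.castSucc) (η b.succ)
        * krawtchoukRest q p h b.castSucc b.succ η ξ := by
  have hij := castSucc_ne_succ b
  rw [bondGen, bondOp, add_mul, krawtchoukProd_eq_mul hij q p h η ξ]
  congr 1
  · rw [cPlus_eq_rateRight]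
    by_cases hη : CanJump η b.castSucc b.succ
    · have exponent (u c : ℝ) : -(1 / 2) * (u - c) = -(1 / 2) * u + c / 2 := by ring
      rw [krawtchoukProd_jump_left_arg hij hη, uExp_jump_right hη, exponent, Real.rpow_add hq,
        krawtchoukRest]
      ring
    · rw [rateRight_of_not_canJump q hη]
      ring
  · rw [cMinus_eq_rateLeft]
    by_cases hη : CanJump η b.succ b.castSucc
    · have exponent (u c : ℝ) : -(1 / 2) * (u + c) = -(1 / 2) * u + -(c / 2) := by ring
      rw [krawtchoukProd_jump_left_arg hij.symm hη, uExp_jump_left hη, exponent,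
        Real.rpow_add hq, Real.rpow_neg hq.le (_ / _), krawtchoukRest, Finset.erase_right_comm]
      ring
    · rw [rateLeft_of_not_canJump q hη]
      ring

lemma CRPlus_eq_dynRight (q ρ : ℝ) (ξ : Config N) (b : Fin m) :
    CRPlus q ρ ξ b.castSucc b.succ = dynRight q (hPlus ρ ξ ((b.castSucc : ℕ) + 2)) (N b.castSucc)
      (N b.succ) (ξ b.castSucc) (ξ b.succ) := by
  simp only [CRPlus, dynRight, hPlus_succ, cPlus_eq_rateRight]

lemma CRMinus_eq_dynLeft (q ρ : ℝ) (ξ : Config N) (b : Fin m) :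
    CRMinus q ρ ξ b.succ b.castSucc = dynLeft q (hPlus ρ ξ ((b.castSucc : ℕ) + 2)) (N b.castSucc)
      (N b.succ) (ξ b.castSucc) (ξ b.succ) := by
  have step : hPlus ρ ξ ((b.castSucc : ℕ) + 2) - (2 * ((ξ b.succ : ℕ) : ℝ) - N b.succ)
      = hPlus ρ ξ ((b.succ : ℕ) + 1 + 1) := sub_eq_iff_eq_add.2 (hPlus_succ ρ ξ b.succ)
  simp only [CRMinus, dynLeft, step]
  rfl

lemma rpow_inv_base {q : ℝ} (hq : 0 < q) (x : ℝ) : q⁻¹ ^ x = q ^ (-x) := by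
  rw [Real.inv_rpow hq.le, Real.rpow_neg hq.le]

lemma qNum_inv {q : ℝ} (hq : 0 < q) (a : ℝ) : qNum q⁻¹ a = qNum q a := by
  simp only [qNum, inv_eq_one, rpow_inv_base hq, neg_neg, inv_inv]
  rw [← neg_sub (q ^ a), ← neg_sub q q⁻¹, neg_div_neg_eq]

lemma rateRight_inv {q : ℝ} (hq : 0 < q) (N₁ N₂ a b : ℕ) :
    rateRight q⁻¹ N₂ N₁ b a = rateLeft q N₁ N₂ a b := by
  rw [rateRight, rateLeft, qNum_inv hq, qNum_inv hq, rpow_inv_base hq, neg_neg]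

lemma rateLeft_inv {q : ℝ} (hq : 0 < q) (N₁ N₂ a b : ℕ) :
    rateLeft q⁻¹ N₂ N₁ b a = rateRight q N₁ N₂ a b := by
  rw [rateRight, rateLeft, qNum_inv hq, qNum_inv hq, rpow_inv_base hq]

lemma bondOp_inv {q : ℝ} (hq : 0 < q) (N₁ N₂ : ℕ) (D : ℝ) (f g : ℕ → ℝ) (a b : ℕ) :
    bondOp q⁻¹ N₂ N₁ D⁻¹ g f b a = bondOp q N₁ N₂ D f g a b := by
  rw [bondOp, bondOp, rateRight_inv hq, rateLeft_inv hq, inv_inv]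
  ring

lemma CLPlus_eq_dynLeft {q : ℝ} (hq : 0 < q) (lam : ℝ) (ζ : Config N) (b : Fin m) :
    CLPlus q lam ζ b.castSucc b.succ = dynLeft q⁻¹ (hMinus lam ζ (b.succ : ℕ)) (N b.succ)
      (N b.castSucc) (ζ b.succ) (ζ b.castSucc) := by
  have step : hMinus lam ζ (b.succ : ℕ) = hMinus lam ζ (b.castSucc : ℕ) + _ :=
    hMinus_succ lam ζ b.castSucc
  have site : (b.castSucc : ℕ) + 1 = (b.succ : ℕ) := rfl
  have site_pred : (b.succ : ℕ) - 1 = (b.castSucc : ℕ) := rfl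
  simp only [CLPlus, dynLeft, rateLeft_inv hq, cPlus_eq_rateRight, rpow_inv_base hq, site,
    site_pred, step]
  congr 2
  · rw [mul_comm]
    congr 3 <;> ring
  · congr 3 <;> ring

lemma CLMinus_eq_dynRight {q : ℝ} (hq : 0 < q) (lam : ℝ) (ζ : Config N) (b : Fin m) :
    CLMinus q lam ζ b.succ b.castSucc = dynRight q⁻¹ (hMinus lam ζ (b.succ : ℕ)) (N b.succ)
      (N b.castSucc) (ζ b.succ) (ζ b.castSucc) := by
  simp only [CLMinus, dynRight, rateRight_inv hq, cMinus_eq_rateLeft, rpow_inv_base hq,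
    Nat.add_sub_cancel, hMinus_succ]
  congr 2
  · rw [mul_comm]
    congr 3 <;> ring
  · congr 3 <;> ring

lemma bondGen_KR {q : ℝ} (hq : 0 < q) (hq1 : q ≠ 1) (ρ : ℝ) (b : Fin m) (η ξ : Config N) :
    bondGen q b (fun η => KR q ρ η ξ) η
      = CRPlus q ρ ξ b.castSucc b.succ * (KR q ρ η (jump ξ b.castSucc b.succ) - KR q ρ η ξ)
        + CRMinus q ρ ξ b.succ b.castSucc
          * (KR q ρ η (jump ξ b.succ b.castSucc) - KR q ρ η ξ) := by
  simp only [KR_eq_krawtchoukProd]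
  rw [bondGen_krawtchoukProd hq, CRPlus_eq_dynRight, CRMinus_eq_dynLeft]
  exact bondOp_kSite_mul_krawtchoukRest q hq hq1 (castSucc_ne_succ b)
    (fun ξ l => hPlus ρ ξ ((l : ℕ) + 2)) (hPlus_succ ρ ξ b.succ)
    (fun h => hPlus_jump_right h ρ) fun h => hPlus_jump_left h ρ

lemma bondGen_KL {q : ℝ} (hq : 0 < q) (hq1 : q ≠ 1) (lam : ℝ) (b : Fin m) (η ζ : Config N) :
    bondGen q b (fun η => KL q lam η ζ) η
      = CLPlus q lam ζ b.castSucc b.succ * (KL q lam η (jump ζ b.castSucc b.succ) - KL q lam η ζ)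
        + CLMinus q lam ζ b.succ b.castSucc
          * (KL q lam η (jump ζ b.succ b.castSucc) - KL q lam η ζ) := by
  simp only [KL_eq_krawtchoukProd]
  rw [bondGen_krawtchoukProd hq, CLPlus_eq_dynLeft hq, CLMinus_eq_dynRight hq, ← bondOp_inv hq,
    ← Real.inv_rpow hq.le, krawtchoukRest_comm, add_comm (N b.castSucc : ℝ), add_comm (_ * _)]
  exact bondOp_kSite_mul_krawtchoukRest q (inv_pos.2 hq) (inv_ne_one.2 hq1)
    (castSucc_ne_succ b).symm (fun ζ l => hMinus lam ζ (l : ℕ)) (hMinus_succ lam ζ b.castSucc)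
    (fun h => hMinus_jump_left h lam) fun h => hMinus_jump_right h lam

lemma isDualityFunction_Rv {q : ℝ} (hq : 0 < q) (hq1 : q ≠ 1) (lam ρ v : ℝ) :
    IsDualityFunction (genL q N lam) (genR q N ρ) (Rv q lam ρ v) := by
  intro ζ ξ
  rw [genL, genR]
  refine Finset.sum_congr rfl fun b _ => ?_
  have reversible := sum_bondGen_mul hq hq1 v b (fun η => KL q lam η ζ) (fun η => KR q ρ η ξ)
  simp only [bondGen_KR hq hq1, bondGen_KL hq hq1, revWeight] at reversible
  simp only [Rv, ← Finset.sum_sub_distrib, Finset.mul_sum, ← Finset.sum_add_distrib]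
  refine Eq.trans (Finset.sum_congr rfl fun η _ => ?_)
    (reversible.trans (Finset.sum_congr rfl fun η _ => ?_)) <;> ring

end Duality

end DynASEP

end

theorem theorem3p19 {m : ℕ} (N : Fin (m + 1) → ℕ) (hN : ∀ i, 0 < N i)
    (q : ℝ) (hq : 0 < q) (hq1 : q ≠ 1) (lam ρ v : ℝ) (hv : v ≠ 0) :
    IsDualityFunction (genL q N lam) (genR q N ρ) (Rv q lam ρ v) ∧
    ∀ ζ ξ : Config N,
      (Regular q lam ρ v ζ ξ → Rv q lam ρ v ζ ξ = racahProduct q lam ρ v ζ ξ) ∧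
      (∀ᶠ v' in 𝓝[≠] v, Regular q lam ρ v' ζ ξ) ∧
      Tendsto (fun v' => racahProduct q lam ρ v' ζ ξ) (𝓝[≠] v) (𝓝 (Rv q lam ρ v ζ ξ)) := by
  exact ⟨isDualityFunction_Rv hq hq1 lam ρ v, fun ζ ξ => ⟨Rv_eq_racahProduct hq hq1 hv,
    eventually_regular q lam ρ v ζ ξ, tendsto_racahProduct hq hq1 lam ρ v ζ ξ⟩⟩
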